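/- For $n\ge 0$ and an $n\times n$ complex matrix $A$, consider germs at $0\in\mathbb{C}^{n+1}$ of systems $$(\ast)\qquad x'=x,\qquad y'=A\cdot y+G(x,y),$$ where $y=(y_1,\dots,y_n)$ and $G\colon(\mathbb{C}^{n+1},0)\to(\mathbb{C}^n,0)$ is holomorphic with $G(x,0)=0$ and $dG(0)=0$. The holonomy of $(\ast)$ is the germ in $\mathrm{Diff}(\mathbb{C}^n,0)$ obtained by lifting, to the leaves of the foliation defined by $(\ast)$, a small positively oriented simple loop $\gamma$ around the origin in $\{y=0\}\setminus\{0\}$, with initial point $x_0$: it sends $y$ near $0$ to the point $y^*$ such that the lift of $\gamma$ (with respect to $(x,y)\mapsto x$) starting at $(x_0,y)$ ends at $(x_0,y^*)$. It is well defined up to holomorphic conjugation, that is, conjugation by an element of $\mathrm{Diff}(\mathbb{C}^n,0)$, the group of germs of biholomorphisms fixing $0$. The matrix $A$ has negative spectrum if all its eigenvalues have negative real part. When $A=\mathrm{diag}(\mu_1,\dots,\mu_n)$, a pair $(j;k)$ with $j\in\mathbb{Z}_{\ge0}^n$, $|j|\ge2$, $1\le k\le n$, is a negative resonance of $e^{2\pi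 iA}$ with respect to $A$ if $\mu_k-j_1\mu_1-\dots-j_n\mu_n$ is a negative integer. **Proposition.** Let $n=2$, $$A=\mathrm{diag}(-3/2,\,-1/4),\qquad h(y_1,y_2)=(-y_1+y_2^2,\,-i\,y_2).$$ Then: 1. $A$ has negative spectrum, $h\in\mathrm{Diff}(\mathbb{C}^2,0)$, $dh(0)=e^{2\pi iA}$, and $((0,2);1)$, the index of the monomial $y_2^2e_1$ of $h$, is a negative resonance of $e^{2\pi iA}$ with respect to $A$. 2. There is no system of the form $(\ast)$ with this matrix $A$ whose holonomy is holomorphically conjugate to $h$. 3. Consequently the following assertion is false: for every $n$, every $n\times n$ complex matrix $B$ with negative spectrum and every $g\in\mathrm{Diff}(\mathbb{C}^n,0)$ with $dg(0)=e^{2\pi iB}$, the germ $g$ is holomorphically conjugate to the holonomy of a system of the form $(\ast)$ with matrix $B$. (This assertion becomes the realization theorem of the paper when one adds the hypothesis that $g$ has a formal normal form with respect to $B$ without negative resonances; so that hypothesis cannot be dropped.) -/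

import Mathlib

open Filter Topology Set

noncomputable section

namespace Foliation

/-- The vector field `x' = x`, `y' = A y + G(x, y)` on `ℂ × ℂⁿ`. -/
def vectorField {n : ℕ} (A : Matrix (Fin n) (Fin n) ℂ)
    (G : ℂ × (Fin n → ℂ) → (Fin n → ℂ)) (p : ℂ × (Fin n → ℂ)) : ℂ × (Fin n → ℂ) :=
  (p.1, A.mulVec p.2 + G p)

/-- `G` is holomorphic on the open neighbourhood `U` of the origin of `ℂ × ℂⁿ`, with `G(x, 0) = 0`
and `dG(0) = 0`; so `vectorField A G` on `U` represents a germ of system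
`x' = x`, `y' = A y + G(x, y)`. -/
structure IsAdmissible {n : ℕ} (U : Set (ℂ × (Fin n → ℂ)))
    (G : ℂ × (Fin n → ℂ) → (Fin n → ℂ)) : Prop where
  isOpen : IsOpen U
  zero_mem : (0 : ℂ × (Fin n → ℂ)) ∈ U
  holomorphic : DifferentiableOn ℂ G U
  vanishing : ∀ x : ℂ, (x, (0 : Fin n → ℂ)) ∈ U → G (x, 0) = 0
  deriv_zero : HasFDerivAt G (0 : ℂ × (Fin n → ℂ) →L[ℂ] (Fin n → ℂ)) 0

/-- A positively oriented simple `C¹` loop `γ : [0, 1] → ℂ \ {0}` around the origin: the index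
`(2πi)⁻¹ ∫ dγ / γ` is one.  (The speed may vanish, so piecewise `C¹` loops are included up to
reparametrization.) -/
structure IsPositiveSimpleLoop (γ : ℝ → ℂ) : Prop where
  contDiffOn : ContDiffOn ℝ 1 γ (Icc 0 1)
  closed : γ 0 = γ 1
  simple : InjOn γ (Ico 0 1)
  ne_zero : ∀ t ∈ Icc (0 : ℝ) 1, γ t ≠ 0
  index_one : ∫ t in (0 : ℝ)..1, derivWithin γ (Icc 0 1) t / γ t = 2 * Real.pi * Complex.I

/-- `w : [0, 1] → U` is a path lying in a leaf of the foliation defined by the vector field `X`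
on `U` (its velocity is everywhere a complex multiple of `X`), and it lies over the path `γ` of the
`x`-axis with respect to the projection `(x, y) ↦ x`. -/
def IsLeafLift {n : ℕ} (U : Set (ℂ × (Fin n → ℂ)))
    (X : ℂ × (Fin n → ℂ) → ℂ × (Fin n → ℂ)) (γ : ℝ → ℂ) (w : ℝ → ℂ × (Fin n → ℂ)) : Prop :=
  ∀ t ∈ Icc (0 : ℝ) 1, w t ∈ U ∧ (w t).1 = γ t ∧
    ∃ c : ℂ, HasDerivWithinAt w (c • X (w t)) (Icc 0 1) t

/-- The germ at `0` of `f` is the holonomy map of the leaf `{y = 0} \ {0}` of the foliation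
defined by `X` on `U`, along the loop `γ` and computed on the transversal `{x = γ 0}`: for `y`
close to `0`, the leafwise lift of `γ` starting at `(γ 0, y)` ends at `(γ 0, f y)`.
The loop is small: it lies in a disc `D` about `0` with `D × {0} ⊆ U`. -/
def IsHolonomy {n : ℕ} (U : Set (ℂ × (Fin n → ℂ)))
    (X : ℂ × (Fin n → ℂ) → ℂ × (Fin n → ℂ)) (γ : ℝ → ℂ) (f : (Fin n → ℂ) → (Fin n → ℂ)) : Prop :=
  (∃ r : ℝ, (∀ t ∈ Icc (0 : ℝ) 1, γ t ∈ Metric.ball (0 : ℂ) r) ∧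
    ∀ x ∈ Metric.ball (0 : ℂ) r, (x, (0 : Fin n → ℂ)) ∈ U) ∧
  ∀ᶠ y in 𝓝 (0 : Fin n → ℂ), ∃ w : ℝ → ℂ × (Fin n → ℂ),
    IsLeafLift U X γ w ∧ w 0 = (γ 0, y) ∧ w 1 = (γ 0, f y)

/-- The germ of `f` at `0` belongs to `Diff(ℂⁿ, 0)`: it fixes `0`, is holomorphic, and has a
holomorphic inverse germ fixing `0`. -/
def IsDiffGerm {n : ℕ} (f : (Fin n → ℂ) → (Fin n → ℂ)) : Prop :=
  f 0 = 0 ∧ AnalyticAt ℂ f 0 ∧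
    ∃ g : (Fin n → ℂ) → (Fin n → ℂ), g 0 = 0 ∧ AnalyticAt ℂ g 0 ∧
      (∀ᶠ y in 𝓝 0, g (f y) = y) ∧ (∀ᶠ y in 𝓝 0, f (g y) = y)

/-- Holomorphic conjugacy of germs at `0`: `φ ∘ f = h ∘ φ` near `0` for some
`φ` in `Diff(ℂⁿ, 0)`. -/
def HolomorphicallyConjugate {n : ℕ} (f h : (Fin n → ℂ) → (Fin n → ℂ)) : Prop :=
  ∃ φ : (Fin n → ℂ) → (Fin n → ℂ), IsDiffGerm φ ∧ ∀ᶠ y in 𝓝 0, φ (f y) = h (φ y)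

/-- Some system `x' = x`, `y' = A y + G(x, y)` with `G(x, 0) = 0`, `dG(0) = 0` has a holonomy
which is holomorphically conjugated to `h`. -/
def IsRealizable {n : ℕ} (A : Matrix (Fin n) (Fin n) ℂ) (h : (Fin n → ℂ) → (Fin n → ℂ)) : Prop :=
  ∃ (U : Set (ℂ × (Fin n → ℂ))) (G : ℂ × (Fin n → ℂ) → (Fin n → ℂ)) (γ : ℝ → ℂ)
    (f : (Fin n → ℂ) → (Fin n → ℂ)),
    IsAdmissible U G ∧ IsPositiveSimpleLoop γ ∧ IsHolonomy U (vectorField A G) γ f ∧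
      HolomorphicallyConjugate f h

/-- All eigenvalues of `A` have negative real part. -/
def HasNegativeSpectrum {n : ℕ} (A : Matrix (Fin n) (Fin n) ℂ) : Prop :=
  ∀ μ ∈ spectrum ℂ A, μ.re < 0

/-- `dh(0) = exp(2πi A)`. -/
def HasLinearPartExp {n : ℕ} (A : Matrix (Fin n) (Fin n) ℂ)
    (h : (Fin n → ℂ) → (Fin n → ℂ)) : Prop :=
  HasFDerivAt h (LinearMap.toContinuousLinearMap
    (Matrix.toLin' (NormedSpace.exp ((2 * Real.pi * Complex.I : ℂ) • A)))) 0

/-- `(j; k)` is a negative resonance of `exp(2πi A)` with respect to `A = diag(μ₁, …, μₙ)`: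
`|j| ≥ 2` and `μₖ - ∑ jₗ μₗ` is a negative integer. -/
def IsNegativeResonance {n : ℕ} (μ : Fin n → ℂ) (j : Fin n → ℕ) (k : Fin n) : Prop :=
  2 ≤ ∑ l, j l ∧ ∃ m : ℤ, m < 0 ∧ μ k - ∑ l, (j l : ℂ) * μ l = (m : ℂ)

end Foliation

end

/-! The obstruction lies in the 2-jet transverse to `y = 0`. For a system with linear part `diag(μ₁,
μ₂)`, one seeks `ψ(x, y) = a(x)·y + b(x)(y, y)` with `a(0) = e₁`, on which the vector field acts as
multiplication by `μ₁ = -3/2` modulo `O(|y|³)`. The coefficients solve a Fuchsian system `x v' =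
M(x) v`, where `M(0)` has the eigenvalues `μ₁ - μⱼ` (`0`, `-5/4`) and `μ₁ - μⱼ - μₖ` (`3/2`, `1/4`,
`-1`). Only positive integer eigenvalues can obstruct a holomorphic solution with `v(0)` in `ker
M(0)` (`exists_fuchsian_solution`). The negative resonance contributes `-1`, which is harmless, so
`ψ` always exists (`exists_semiinvariant_jet`).

Along leafwise lifts of `γ`, `ψ` obeys `u' = (γ'/γ)(μ₁ u + O(|y|³))`. Hence the holonomy `f`
satisfies `ψ ∘ f = e^{2πiμ₁} ψ + O(|y|³) = -ψ + O(|y|³)` on the transversal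
(`IsHolonomy.exists_semiinvariant`). There the linear part of `ψ` is nonzero, since `a` solves a
homogeneous linear equation and cannot vanish at one point without vanishing at `0`
(`eq_zero_of_fuchsian`).

If `φ` conjugates `f` to `h`, then `η = ψ ∘ φ⁻¹` satisfies `η ∘ h + η = O(|z|³)`. Let `α z₁ + β z₂`
be the linear part of `η` and `q z₂²` its pure quadratic term in `z₂`. The coefficient of `z₂` gives
`(1 - i) β = 0`. That of `z₂²` is `α + q((-i)² + 1) = α`, so `α = 0` too. Thus `dη(0) = 0`, a
contradiction (`fderiv_eq_zero_of_semiinvariant`). -/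

noncomputable section

namespace Foliation

/-! ### Holomorphic maps between normed spaces: regularity of the derivative. -/

section ComplexAnalysis

variable {E F : Type*} [NormedAddCommGroup E] [NormedSpace ℂ E] [NormedAddCommGroup F]
  [NormedSpace ℂ F]

/-- The Cauchy estimate for the Fréchet derivative. -/
theorem norm_fderiv_le_of_ball {G : E → F} {p : E} {δ M : ℝ} (hδ : 0 < δ)
    (hG : DifferentiableOn ℂ G (Metric.ball p δ)) (hM : ∀ z ∈ Metric.ball p δ, ‖G z‖ ≤ M) :
    ‖fderiv ℂ G p‖ ≤ 2 * M / δ := by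
  have hM0 : 0 ≤ M := (norm_nonneg _).trans (hM p (Metric.mem_ball_self hδ))
  refine ContinuousLinearMap.opNorm_le_bound _ (by positivity) fun w => ?_
  rcases eq_or_ne w 0 with rfl | hw
  · simp
  have hw0 : 0 < ‖w‖ := norm_pos_iff.2 hw
  set R : ℝ := δ / (2 * ‖w‖) with hR
  have hR0 : 0 < R := by positivity
  have hmem : ∀ s ∈ Metric.closedBall (0 : ℂ) R, p + s • w ∈ Metric.ball p δ := by
    intro s hs
    rw [mem_closedBall_zero_iff] at hs
    rw [mem_ball_iff_norm, add_sub_cancel_left, norm_smul]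
    calc ‖s‖ * ‖w‖ ≤ R * ‖w‖ := by gcongr
      _ = δ / 2 := by rw [hR]; field_simp
      _ < δ := by linarith
  have hline : ∀ s : ℂ, HasDerivAt (fun s : ℂ => p + s • w) w s := fun s => by
    simpa using ((hasDerivAt_id s).smul_const w).const_add p
  have hd : DifferentiableOn ℂ (fun s : ℂ => G (p + s • w)) (Metric.closedBall 0 R) :=
    hG.comp (fun s _ => (hline s).differentiableAt.differentiableWithinAt) hmem
  have hdiff : HasDerivAt (fun s : ℂ => G (p + s • w)) (fderiv ℂ G p w) 0 := by
    have h1 : HasFDerivAt G (fderiv ℂ G p) (p + (0 : ℂ) • w) := by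
      rw [zero_smul, add_zero]
      exact (hG.differentiableAt (Metric.ball_mem_nhds p hδ)).hasFDerivAt
    exact h1.comp_hasDerivAt 0 (hline 0)
  have := Complex.norm_deriv_le_of_forall_mem_sphere_norm_le hR0
    (hd.diffContOnCl_ball Subset.rfl)
    (fun s hs => hM _ (hmem s (Metric.sphere_subset_closedBall hs)))
  rw [hdiff.deriv] at this
  refine this.trans (le_of_eq ?_)
  rw [hR]; field_simp

/-- The Cauchy estimate is used twice. It bounds the derivative near `p`, so `G` is Lipschitz there.
Applied to `z ↦ G (z + (q - p)) - G z`, which is therefore `O(‖q - p‖)`, it bounds `‖G'(q) - G'(p)‖`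
by a multiple of `‖q - p‖`. -/
theorem continuousOn_fderiv_of_differentiableOn {G : E → F} {U : Set E} (hU : IsOpen U)
    (hG : DifferentiableOn ℂ G U) : ContinuousOn (fderiv ℂ G) U := by
  intro p hp
  refine ContinuousAt.continuousWithinAt ?_
  have hc : ContinuousAt G p := (hG.differentiableAt (hU.mem_nhds hp)).continuousAt
  obtain ⟨δ, hδ, hball⟩ := Metric.eventually_nhds_iff_ball.1
    ((hU.eventually_mem hp).and
      (hc.norm.eventually (gt_mem_nhds (lt_add_one ‖G p‖))))
  set M := ‖G p‖ + 1
  have hM0 : 0 < M := by positivity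
  have hGd : ∀ z ∈ Metric.ball p δ, DifferentiableAt ℂ G z := fun z hz =>
    hG.differentiableAt (hU.mem_nhds (hball z hz).1)
  set K := 2 * M / (δ / 2)
  have hsub : ∀ z ∈ Metric.ball p (δ / 2), Metric.ball z (δ / 2) ⊆ Metric.ball p δ := by
    intro z hz
    refine Metric.ball_subset_ball' ?_
    have := Metric.mem_ball.1 hz
    linarith
  have hK : ∀ z ∈ Metric.ball p (δ / 2), ‖fderiv ℂ G z‖ ≤ K := fun z hz =>
    norm_fderiv_le_of_ball (by positivity)
      (fun u hu => (hGd u (hsub z hz hu)).differentiableWithinAt)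
      (fun u hu => (hball u (hsub z hz hu)).2.le)
  have hlip : ∀ z ∈ Metric.ball p (δ / 2), ∀ u ∈ Metric.ball p (δ / 2),
      ‖G u - G z‖ ≤ K * ‖u - z‖ := fun z hz u hu =>
    (convex_ball p (δ / 2)).norm_image_sub_le_of_norm_fderiv_le (𝕜 := ℂ)
      (fun v hv => hGd v (Metric.ball_subset_ball (by linarith) hv)) hK hz hu
  have hmain : ∀ q ∈ Metric.ball p (δ / 4),
      ‖fderiv ℂ G q - fderiv ℂ G p‖ ≤ 2 * K / (δ / 4) * ‖q - p‖ := by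
    intro q hq
    rw [mem_ball_iff_norm] at hq
    have hmem : ∀ z ∈ Metric.ball p (δ / 4),
        z + (q - p) ∈ Metric.ball p (δ / 2) ∧ z ∈ Metric.ball p (δ / 2) := by
      intro z hz
      rw [mem_ball_iff_norm] at hz
      refine ⟨?_, by rw [mem_ball_iff_norm]; linarith⟩
      rw [mem_ball_iff_norm, show z + (q - p) - p = (z - p) + (q - p) by abel]
      exact (norm_add_le _ _).trans_lt (by linarith)
    have hbig : Metric.ball p (δ / 2) ⊆ Metric.ball p δ := Metric.ball_subset_ball (by linarith)
    have hH : DifferentiableOn ℂ (fun z => G (z + (q - p)) - G z) (Metric.ball p (δ / 4)) := by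
      intro z hz
      have h1 : DifferentiableAt ℂ (fun z => G (z + (q - p))) z :=
        (hGd _ (hbig (hmem z hz).1)).comp z (by fun_prop)
      exact (h1.sub (hGd _ (hbig (hmem z hz).2))).differentiableWithinAt
    have hb : ∀ z ∈ Metric.ball p (δ / 4), ‖G (z + (q - p)) - G z‖ ≤ K * ‖q - p‖ := by
      intro z hz
      simpa using hlip z (hmem z hz).2 _ (hmem z hz).1
    have := norm_fderiv_le_of_ball (by positivity : 0 < δ / 4) hH hb
    have hp' : p ∈ Metric.ball p (δ / 4) := Metric.mem_ball_self (by positivity)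
    have h1 : DifferentiableAt ℂ (fun z => G (z + (q - p))) p :=
        (hGd _ (hbig (hmem p hp').1)).comp p (by fun_prop)
    have h2 : fderiv ℂ (fun z => G (z + (q - p)) - G z) p = fderiv ℂ G q - fderiv ℂ G p := by
      rw [fderiv_fun_sub h1 (hGd _ (hbig (hmem p hp').2)), fderiv_comp_add_right]
      congr 2; abel
    rw [h2] at this
    refine this.trans (le_of_eq ?_)
    ring
  rw [ContinuousAt, tendsto_iff_norm_sub_tendsto_zero]
  refine squeeze_zero' (Eventually.of_forall fun _ => norm_nonneg _)
    (Filter.mem_of_superset (Metric.ball_mem_nhds p (by positivity : 0 < δ / 4)) hmain) ?_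
  have : Continuous fun q : E => 2 * K / (δ / 4) * ‖q - p‖ := by fun_prop
  simpa using this.tendsto p

/-- Directional derivatives of a holomorphic function are holomorphic. -/
theorem differentiableOn_fderiv_apply [CompleteSpace F] {G : E → F} {U : Set E} (hU : IsOpen U)
    (hG : DifferentiableOn ℂ G U) (v : E) : DifferentiableOn ℂ (fun p => fderiv ℂ G p v) U := by
  intro p hp
  refine DifferentiableAt.differentiableWithinAt ?_
  have hcont := continuousOn_fderiv_of_differentiableOn hU hG
  have hc : ContinuousAt (fderiv ℂ G) p := hcont.continuousAt (hU.mem_nhds hp)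
  obtain ⟨δ, hδ, hball⟩ := Metric.eventually_nhds_iff_ball.1
    ((hU.eventually_mem hp).and
      (hc.norm.eventually (gt_mem_nhds (lt_add_one ‖fderiv ℂ G p‖))))
  set K := ‖fderiv ℂ G p‖ + 1
  set R : ℝ := δ / (2 * (‖v‖ + 1)) with hR
  have hR0 : 0 < R := by positivity
  have hmem : ∀ q ∈ Metric.ball p (δ / 2), ∀ s ∈ Metric.closedBall (0 : ℂ) R,
      q + s • v ∈ Metric.ball p δ := by
    intro q hq s hs
    rw [mem_closedBall_zero_iff] at hs
    rw [mem_ball_iff_norm] at hq ⊢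
    have h1 : ‖s • v‖ ≤ δ / 2 := by
      rw [norm_smul]
      calc ‖s‖ * ‖v‖ ≤ R * (‖v‖ + 1) := by gcongr; linarith
        _ = δ / 2 := by rw [hR]; field_simp
    rw [show q + s • v - p = (q - p) + s • v by abel]
    exact (norm_add_le _ _).trans_lt (by linarith)
  have hline : ∀ q : E, ∀ s : ℂ, HasDerivAt (fun s : ℂ => q + s • v) v s := fun q s => by
    simpa using ((hasDerivAt_id s).smul_const v).const_add q
  have hGd : ∀ z ∈ Metric.ball p δ, DifferentiableAt ℂ G z := fun z hz =>
    hG.differentiableAt (hU.mem_nhds (hball z hz).1)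
  -- The directional derivative is a Cauchy integral over a circle whose radius does not depend on
  -- `q`, so it can be differentiated in `q` under the integral sign.
  have hform : ∀ q ∈ Metric.ball p (δ / 2),
      Complex.cderiv R (fun s : ℂ => G (q + s • v)) 0 = fderiv ℂ G q v := by
    intro q hq
    have hq' : q ∈ Metric.ball p δ := Metric.ball_subset_ball (by linarith) hq
    have hW : IsOpen ((fun s : ℂ => q + s • v) ⁻¹' Metric.ball p δ) :=
      Metric.isOpen_ball.preimage (by fun_prop)
    have hd : DifferentiableOn ℂ (fun s : ℂ => G (q + s • v))
        ((fun s : ℂ => q + s • v) ⁻¹' Metric.ball p δ) := fun s hs =>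
      ((hGd _ hs).comp s (hline q s).differentiableAt).differentiableWithinAt
    rw [Complex.cderiv_eq_deriv hW hd hR0 (fun s hs => hmem q hq s hs)]
    have h1 : HasFDerivAt G (fderiv ℂ G q) (q + (0 : ℂ) • v) := by
      rw [zero_smul, add_zero]; exact (hGd q hq').hasFDerivAt
    exact (h1.comp_hasDerivAt 0 (hline q 0)).deriv
  have hev : (fun q => fderiv ℂ G q v) =ᶠ[𝓝 p]
      fun q => Complex.cderiv R (fun s : ℂ => G (q + s • v)) 0 :=
    Filter.mem_of_superset (Metric.ball_mem_nhds p (by positivity : 0 < δ / 2))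
      fun q hq => (hform q hq).symm
  refine DifferentiableAt.congr_of_eventuallyEq ?_ hev
  unfold Complex.cderiv circleIntegral
  refine DifferentiableAt.const_smul ?_ _
  have hcirc : ∀ θ : ℝ, circleMap 0 R θ ∈ Metric.closedBall (0 : ℂ) R := fun θ =>
    circleMap_mem_closedBall 0 hR0.le θ
  have hinv : Continuous fun θ : ℝ => ((circleMap 0 R θ - 0) ^ 2)⁻¹ := by
    refine Continuous.inv₀ (by fun_prop) fun θ => ?_
    rw [sub_zero]
    exact pow_ne_zero _ (circleMap_ne_center hR0.ne')
  have hcm : Continuous fun θ : ℝ => deriv (circleMap 0 R) θ := by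
    simp only [deriv_circleMap]; fun_prop
  have hgc : ∀ q ∈ Metric.ball p (δ / 2), Continuous fun θ : ℝ => G (q + circleMap 0 R θ • v) := by
    intro q hq
    rw [continuous_iff_continuousAt]
    intro θ
    exact ContinuousAt.comp (f := fun θ : ℝ => q + circleMap 0 R θ • v)
      (hGd _ (hmem q hq _ (hcirc θ))).continuousAt (by fun_prop)
  have hg'c : Continuous fun θ : ℝ => fderiv ℂ G (p + circleMap 0 R θ • v) := by
    rw [continuous_iff_continuousAt]
    intro θ
    refine ContinuousAt.comp (f := fun θ : ℝ => p + circleMap 0 R θ • v) ?_ (by fun_prop)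
    exact hcont.continuousAt (hU.mem_nhds
      (hball _ (hmem p (Metric.mem_ball_self (by positivity)) _ (hcirc θ))).1)
  refine (intervalIntegral.hasFDerivAt_integral_of_dominated_of_fderiv_le
    (F' := fun q θ => deriv (circleMap 0 R) θ • ((circleMap 0 R θ - 0) ^ 2)⁻¹ •
      fderiv ℂ G (q + circleMap 0 R θ • v))
    (bound := fun θ => ‖deriv (circleMap 0 R) θ‖ * (‖((circleMap 0 R θ - 0) ^ 2)⁻¹‖ * K))
    (Metric.ball_mem_nhds p (by positivity : 0 < δ / 2)) ?_ ?_ ?_ ?_ ?_ ?_).differentiableAt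
  · filter_upwards [Metric.ball_mem_nhds p (by positivity : 0 < δ / 2)] with q hq
    exact (hcm.smul (hinv.smul (hgc q hq))).aestronglyMeasurable
  · exact (hcm.smul (hinv.smul
      (hgc p (Metric.mem_ball_self (by positivity))))).intervalIntegrable _ _
  · exact (hcm.smul (hinv.smul hg'c)).aestronglyMeasurable
  · refine Eventually.of_forall fun θ _ q hq => ?_
    rw [norm_smul, norm_smul]
    gcongr
    exact (hball _ (hmem q hq _ (hcirc θ))).2.le
  · exact (hcm.norm.mul (hinv.norm.mul continuous_const)).intervalIntegrable _ _
  · refine Eventually.of_forall fun θ _ q hq => ?_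
    have h1 := (hGd _ (hmem q hq _ (hcirc θ))).hasFDerivAt.comp q
      ((hasFDerivAt_id q).add_const (circleMap 0 R θ • v))
    rw [ContinuousLinearMap.comp_id] at h1
    exact (h1.const_smul _).const_smul _

end ComplexAnalysis

/-! ### Power series solutions of Fuchsian systems. -/

section Fuchsian

variable {R : Type*} [NormedRing R]

/-- The coefficients of the power series solution of `x W' = M(x) W`, `W(0) = W₀`, where
`M(x) = ∑ mₖ xᵏ`. -/
def fuchsCoeff (m : ℕ → R) (W₀ : R) : ℕ → R
  | 0 => W₀
  | k + 1 => Ring.inverse (((k + 1 : ℕ) : R) - m 0) *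
      ∑ j : Fin (k + 1), m (j + 1) * fuchsCoeff m W₀ (k - j)

theorem fuchsCoeff_recursion {m : ℕ → R} {W₀ : R}
    (hunit : ∀ k : ℕ, IsUnit (((k + 1 : ℕ) : R) - m 0)) (k : ℕ) :
    ((k + 1 : ℕ) : R) * fuchsCoeff m W₀ (k + 1) = m 0 * fuchsCoeff m W₀ (k + 1) +
      ∑ j ∈ Finset.range (k + 1), m (j + 1) * fuchsCoeff m W₀ (k - j) := by
  have h := Ring.mul_inverse_cancel_left _
    (∑ j : Fin (k + 1), m (j + 1) * fuchsCoeff m W₀ (k - j)) (hunit k)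
  rw [← fuchsCoeff, sub_mul] at h
  rw [← Fin.sum_univ_eq_sum_range fun j => m (j + 1) * fuchsCoeff m W₀ (k - j), ← h]
  abel

theorem fuchsCoeff_sum {m : ℕ → R} {W₀ : R}
    (hunit : ∀ k : ℕ, IsUnit (((k + 1 : ℕ) : R) - m 0)) (h0 : m 0 * W₀ = 0) (k : ℕ) :
    ∑ j ∈ Finset.range (k + 1), m j * fuchsCoeff m W₀ (k - j) = (k : R) * fuchsCoeff m W₀ k := by
  cases k with
  | zero => simp [fuchsCoeff, h0]
  | succ k =>
    rw [fuchsCoeff_recursion hunit, Finset.sum_range_succ', add_comm]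
    simp

/-- Once the index exceeds `‖m 0‖ + B / (1 - q)`, the recursion cannot enlarge a bound valid for all
earlier terms. The constant therefore only has to dominate finitely many initial terms, and no
estimate of the inverses is needed. -/
theorem fuchsCoeff_bound [NormedAlgebra ℂ R] {m : ℕ → R} {W₀ : R}
    (hunit : ∀ k : ℕ, IsUnit (((k + 1 : ℕ) : R) - m 0)) {s q B : ℝ} (hs : 0 ≤ s)
    (hq0 : 0 ≤ q) (hq1 : q < 1) (hB : ∀ k, ‖m k‖ * s ^ k ≤ B * q ^ k) :
    ∃ C, ∀ k, ‖fuchsCoeff m W₀ k‖ * s ^ k ≤ C := by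
  set w := fuchsCoeff m W₀ with hw
  have hB0 : 0 ≤ B := by simpa using (by positivity : 0 ≤ ‖m 0‖ * s ^ 0).trans (hB 0)
  have hq : 0 < 1 - q := by linarith
  obtain ⟨N, hN⟩ := exists_nat_ge (‖m 0‖ + B * (1 - q)⁻¹)
  obtain ⟨C, hC⟩ : ∃ C, C = ∑ j ∈ Finset.range (N + 1), ‖w j‖ * s ^ j := ⟨_, rfl⟩
  have hC0 : 0 ≤ C := hC ▸ Finset.sum_nonneg fun j _ => by positivity
  refine ⟨C, fun k => ?_⟩
  induction k using Nat.strong_induction_on with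
  | _ k ih =>
    rcases lt_or_ge k (N + 1) with hk | hk
    · rw [hC]
      exact Finset.single_le_sum (f := fun j => ‖w j‖ * s ^ j) (fun j _ => by positivity)
        (Finset.mem_range.2 hk)
    · obtain ⟨k, rfl⟩ : ∃ l, k = l + 1 := ⟨k - 1, by omega⟩
      have hrec := congrArg norm (fuchsCoeff_recursion (W₀ := W₀) hunit k)
      -- The integer factor becomes a complex scalar, because its image in `R` is not assumed to
      -- have norm `k + 1`.
      rw [← hw, ← nsmul_eq_mul, ← Nat.cast_smul_eq_nsmul ℂ, norm_smul, Complex.norm_natCast] at hrec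
      have h1 : ((k + 1 : ℕ) : ℝ) * ‖w (k + 1)‖ ≤ ‖m 0‖ * ‖w (k + 1)‖ +
          ∑ j ∈ Finset.range (k + 1), ‖m (j + 1)‖ * ‖w (k - j)‖ := by
        rw [hrec]
        refine (norm_add_le _ _).trans (add_le_add (norm_mul_le _ _) ?_)
        exact (norm_sum_le _ _).trans (Finset.sum_le_sum fun j _ => norm_mul_le _ _)
      have h2 : (∑ j ∈ Finset.range (k + 1), ‖m (j + 1)‖ * ‖w (k - j)‖) * s ^ (k + 1) ≤
          B * (1 - q)⁻¹ * C := by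
        rw [Finset.sum_mul]
        calc ∑ j ∈ Finset.range (k + 1), ‖m (j + 1)‖ * ‖w (k - j)‖ * s ^ (k + 1)
            ≤ ∑ j ∈ Finset.range (k + 1), B * C * q ^ j := by
              refine Finset.sum_le_sum fun j hj => ?_
              have hj' : j ≤ k := by have := Finset.mem_range.1 hj; omega
              have e : s ^ (k + 1) = s ^ (j + 1) * s ^ (k - j) := by
                rw [← pow_add]; congr 1; omega
              calc ‖m (j + 1)‖ * ‖w (k - j)‖ * s ^ (k + 1)
                  = (‖m (j + 1)‖ * s ^ (j + 1)) * (‖w (k - j)‖ * s ^ (k - j)) := by rw [e]; ring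
                _ ≤ (B * q ^ (j + 1)) * C :=
                    mul_le_mul (hB _) (ih _ (by omega)) (by positivity) (by positivity)
                _ ≤ (B * q ^ j) * C := by
                    gcongr ?_ * _
                    gcongr ?_ * ?_
                    exact pow_le_pow_of_le_one hq0 hq1.le (by omega)
                _ = B * C * q ^ j := by ring
          _ = B * C * ∑ j ∈ Finset.range (k + 1), q ^ j := by rw [Finset.mul_sum]
          _ ≤ B * C * (1 - q)⁻¹ := by
              gcongr
              rw [← tsum_geometric_of_lt_one hq0 hq1]
              exact (summable_geometric_of_lt_one hq0 hq1).sum_le_tsum _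
                (fun _ _ => by positivity)
          _ = B * (1 - q)⁻¹ * C := by ring
      have hsk : 0 ≤ s ^ (k + 1) := by positivity
      have h3 : ((k + 1 : ℕ) : ℝ) * (‖w (k + 1)‖ * s ^ (k + 1)) ≤
          ‖m 0‖ * (‖w (k + 1)‖ * s ^ (k + 1)) + B * (1 - q)⁻¹ * C := by
        have := mul_le_mul_of_nonneg_right h1 hsk
        rw [add_mul] at this
        linarith
      have hk' : (N : ℝ) + 1 ≤ ((k + 1 : ℕ) : ℝ) := by exact_mod_cast hk
      by_contra! hcon
      have hu : 0 ≤ ‖w (k + 1)‖ * s ^ (k + 1) := by positivity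
      set u := ‖w (k + 1)‖ * s ^ (k + 1)
      have hBq : 0 ≤ B * (1 - q)⁻¹ := by positivity
      have h4 : (‖m 0‖ + B * (1 - q)⁻¹ + 1) * u ≤ ((k + 1 : ℕ) : ℝ) * u := by
        gcongr; linarith
      have h5 : B * (1 - q)⁻¹ * C ≤ B * (1 - q)⁻¹ * u := by gcongr
      nlinarith

/-- Existence of a holomorphic solution of the Fuchsian system `x W' = M(x) W` with initial value
in the kernel of `M(0)`, if no positive integer is an eigenvalue of `M(0)`. -/
theorem exists_fuchsian_solution [NormedAlgebra ℂ R] [CompleteSpace R] {M : ℂ → R} {r : ℝ}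
    (hM : DifferentiableOn ℂ M (Metric.ball 0 r))
    (hunit : ∀ k : ℕ, IsUnit (((k + 1 : ℕ) : R) - M 0)) {W₀ : R} (h0 : M 0 * W₀ = 0) :
    ∃ W : ℂ → R, DifferentiableOn ℂ W (Metric.ball 0 r) ∧ W 0 = W₀ ∧
      ∀ x ∈ Metric.ball (0 : ℂ) r, x • deriv W x = M x * W x := by
  set m : ℕ → R := fun k => (k.factorial : ℂ)⁻¹ • iteratedDeriv k M 0 with hm
  have hm0 : m 0 = M 0 := by simp [hm]
  have hMsum : ∀ x ∈ Metric.ball (0 : ℂ) r, HasSum (fun k => x ^ k • m k) (M x) := by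
    intro x hx
    refine (Complex.hasSum_taylorSeries_on_ball hM hx).congr_fun ?_
    intro k
    rw [sub_zero, hm, smul_comm]
  rw [← hm0] at hunit h0
  set w := fuchsCoeff m W₀ with hw
  have hmbound : ∀ t, 0 < t → t < r → ∃ B, ∀ k, ‖m k‖ * t ^ k ≤ B := by
    intro t ht htr
    have hx : (t : ℂ) ∈ Metric.ball (0 : ℂ) r := by
      rw [mem_ball_zero_iff, Complex.norm_real, Real.norm_of_nonneg ht.le]; exact htr
    obtain ⟨B, hB⟩ := (hMsum _ hx).summable.tendsto_atTop_zero.norm.bddAbove_range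
    refine ⟨B, fun k => ?_⟩
    have := hB (mem_range_self k)
    rwa [norm_smul, norm_pow, Complex.norm_real, Real.norm_of_nonneg ht.le, mul_comm] at this
  have hwbound : ∀ t, 0 < t → t < r → ∃ C, ∀ k, ‖w k‖ * t ^ k ≤ C := by
    intro t ht htr
    -- Boundedness at the larger radius `t'` gives geometric decay with ratio `t / t'` at radius
    -- `t`.
    obtain ⟨t', h1, h2⟩ := exists_between htr
    have ht' : 0 < t' := ht.trans h1
    obtain ⟨B, hB⟩ := hmbound t' ht' h2
    refine fuchsCoeff_bound hunit ht.le (q := t / t') (B := B) (by positivity)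
      ((div_lt_one ht').2 h1) fun k => ?_
    calc ‖m k‖ * t ^ k = (‖m k‖ * t' ^ k) * (t / t') ^ k := by
          rw [div_pow]; field_simp
      _ ≤ B * (t / t') ^ k := by gcongr; exact hB k
  have hgeom : ∀ (c : ℕ → R) (s t C : ℝ), 0 < t → (∀ k, ‖c k‖ * t ^ k ≤ C) →
      ∀ k, ∀ x ∈ Metric.ball (0 : ℂ) s, ‖x ^ k • c k‖ ≤ C * (s / t) ^ k := by
    intro c s t C ht hC k x hx
    rw [mem_ball_zero_iff] at hx
    have hs : 0 < s := (norm_nonneg _).trans_lt hx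
    rw [norm_smul, norm_pow]
    calc ‖x‖ ^ k * ‖c k‖ ≤ s ^ k * ‖c k‖ := by gcongr
      _ = (‖c k‖ * t ^ k) * (s / t) ^ k := by rw [div_pow]; field_simp
      _ ≤ C * (s / t) ^ k := by gcongr; exact hC k
  have key : ∀ x ∈ Metric.ball (0 : ℂ) r,
      DifferentiableAt ℂ (fun x => ∑' k, x ^ k • w k) x ∧
      x • deriv (fun x => ∑' k, x ^ k • w k) x = M x * ∑' k, x ^ k • w k := by
    intro x hx
    rw [mem_ball_zero_iff] at hx
    obtain ⟨s, hxs, hsr⟩ := exists_between hx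
    obtain ⟨t, hst, htr⟩ := exists_between hsr
    have hs : 0 < s := (norm_nonneg _).trans_lt hxs
    have ht : 0 < t := hs.trans hst
    obtain ⟨C, hC⟩ := hwbound t ht htr
    obtain ⟨B, hB⟩ := hmbound t ht htr
    have hxs' : x ∈ Metric.ball (0 : ℂ) s := by rwa [mem_ball_zero_iff]
    have hq0 : 0 ≤ s / t := by positivity
    have hq1 : s / t < 1 := (div_lt_one ht).2 hst
    have hsum : ∀ D : ℝ, Summable fun k => D * (s / t) ^ k := fun D =>
      (summable_geometric_of_lt_one hq0 hq1).mul_left D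
    have hterm : ∀ k : ℕ, DifferentiableOn ℂ (fun x : ℂ => x ^ k • w k) (Metric.ball 0 s) :=
      fun k => by fun_prop
    have hdiff := Complex.differentiableOn_tsum_of_summable_norm (hsum C) hterm
      Metric.isOpen_ball (hgeom w s t C ht hC)
    have hder := Complex.hasSum_deriv_of_summable_norm (hsum C) hterm
      Metric.isOpen_ball (hgeom w s t C ht hC) hxs'
    refine ⟨hdiff.differentiableAt (Metric.isOpen_ball.mem_nhds hxs'), ?_⟩
    have hfs : Summable fun k => ‖x ^ k • m k‖ :=
      (hsum B).of_nonneg_of_le (fun _ => norm_nonneg _) fun k => hgeom m s t B ht hB k x hxs'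
    have hgs : Summable fun k => ‖x ^ k • w k‖ :=
      (hsum C).of_nonneg_of_le (fun _ => norm_nonneg _) fun k => hgeom w s t C ht hC k x hxs'
    have hprod := hasSum_sum_range_mul_of_summable_norm hfs hgs
    rw [(hMsum x (by rwa [mem_ball_zero_iff])).tsum_eq] at hprod
    refine (hder.const_smul x).unique ?_
    refine hprod.congr_fun ?_
    intro k
    have h1 : deriv (fun x : ℂ => x ^ k • w k) x = ((k : ℂ) * x ^ (k - 1)) • w k :=
      ((hasDerivAt_pow k x).smul_const (w k)).deriv
    have h2 : ∑ j ∈ Finset.range (k + 1), (x ^ j • m j) * (x ^ (k - j) • w (k - j)) =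
        x ^ k • ((k : R) * w k) := by
      rw [← fuchsCoeff_sum hunit h0, Finset.smul_sum]
      refine Finset.sum_congr rfl fun j hj => ?_
      have hj' : j ≤ k := by have := Finset.mem_range.1 hj; omega
      rw [smul_mul_smul_comm, ← pow_add, Nat.add_sub_cancel' hj']
    rw [h1, h2, ← nsmul_eq_mul k (w k), ← Nat.cast_smul_eq_nsmul ℂ k (w k), smul_smul, smul_smul]
    congr 1
    cases k with
    | zero => simp
    | succ k => simp only [Nat.add_sub_cancel]; ring
  refine ⟨fun x => ∑' k, x ^ k • w k, fun x hx => (key x hx).1.differentiableWithinAt, ?_,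
    fun x hx => (key x hx).2⟩
  change ∑' k, (0 : ℂ) ^ k • w k = W₀
  rw [tsum_eq_single 0 fun k hk => by simp [hk]]
  simp [hw, fuchsCoeff]

end Fuchsian

/-! ### Expansion of `G` to order two in `y`, with coefficients holomorphic in `x`. -/

section Taylor

/-- The second order Taylor estimate for a holomorphic function on a disc of radius `R ≥ 2`. -/
theorem norm_taylor_two_le {F : Type*} [NormedAddCommGroup F] [NormedSpace ℂ F] [CompleteSpace F]
    {g : ℂ → F} {R M : ℝ} (hR : 2 ≤ R) (hg : DiffContOnCl ℂ g (Metric.ball 0 R))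
    (hM : ∀ z ∈ Metric.sphere (0 : ℂ) R, ‖g z‖ ≤ M) :
    ‖g 1 - (g 0 + deriv g 0 + (2 : ℂ)⁻¹ • deriv (deriv g) 0)‖ ≤ 2 * M / R ^ 3 := by
  have hR0 : 0 < R := by linarith
  have h1 : (1 : ℂ) ∈ Metric.ball (0 : ℂ) R := by
    rw [mem_ball_zero_iff, norm_one]; linarith
  have hs := Complex.hasSum_taylorSeries_on_ball hg.differentiableOn h1
  rw [← hasSum_nat_add_iff' 3] at hs
  have hM0 : 0 ≤ M := (norm_nonneg _).trans (hM (R : ℂ) (by simp [abs_of_pos hR0]))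
  have hbound : ∀ n : ℕ, ‖(((n + 3).factorial : ℕ) : ℂ)⁻¹ • ((1 : ℂ) - 0) ^ (n + 3) •
      iteratedDeriv (n + 3) g 0‖ ≤ M / R ^ 3 * (1 / 2) ^ n := by
    intro n
    have hfac : (0 : ℝ) < ((n + 3).factorial : ℕ) := by positivity
    have hc := Complex.norm_iteratedDeriv_le_of_forall_mem_sphere_norm_le (n + 3) hR0 hg hM
    rw [sub_zero, one_pow, one_smul, norm_smul, norm_inv, Complex.norm_natCast]
    calc (((n + 3).factorial : ℕ) : ℝ)⁻¹ * ‖iteratedDeriv (n + 3) g 0‖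
        ≤ (((n + 3).factorial : ℕ) : ℝ)⁻¹ * (((n + 3).factorial : ℕ) * M / R ^ (n + 3)) := by
          gcongr
      _ = M / R ^ 3 * (1 / R) ^ n := by rw [pow_add, div_pow, one_pow]; field_simp
      _ ≤ M / R ^ 3 * (1 / 2) ^ n := by gcongr
  -- Since `1 / R ≤ 1 / 2`, the tail is dominated by a geometric series of sum `2`, the source of
  -- the factor in the bound.
  have := hs.norm_le_of_bounded (hasSum_geometric_two.mul_left (M / R ^ 3)) hbound
  simp only [Finset.sum_range_succ, Finset.sum_range_zero, iteratedDeriv_zero, iteratedDeriv_succ,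
    sub_zero, one_pow, one_smul, zero_add, Nat.factorial] at this
  simp only [Nat.cast_one, inv_one, one_smul, mul_one] at this
  refine this.trans (le_of_eq (by ring))

variable {n : ℕ}

/-- The coefficients, up to order two in `y`, of a holomorphic `G(x, y)` vanishing on `y = 0`. -/
theorem IsAdmissible.exists_transverse_jet {U : Set (ℂ × (Fin n → ℂ))}
    {G : ℂ × (Fin n → ℂ) → (Fin n → ℂ)} (hG : IsAdmissible U G) {r : ℝ}
    (hball : ∀ x ∈ Metric.ball (0 : ℂ) r, (x, (0 : Fin n → ℂ)) ∈ U) :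
    ∃ (L : Fin n → Fin n → ℂ → ℂ) (Q : Fin n → Fin n → Fin n → ℂ → ℂ),
      (∀ i j, DifferentiableOn ℂ (L i j) (Metric.ball 0 r)) ∧
      (∀ i j k, DifferentiableOn ℂ (Q i j k) (Metric.ball 0 r)) ∧ (∀ i j, L i j 0 = 0) ∧
      ∀ ρ < r, ∃ δ > 0, ∃ C ≥ 0, ∀ x, ‖x‖ ≤ ρ → ∀ y, ‖y‖ ≤ δ → (x, y) ∈ U ∧
        ∀ i, ‖G (x, y) i - ∑ j, L i j x * y j - ∑ j, ∑ k, Q i j k x * y j * y k‖ ≤ C * ‖y‖ ^ 3 := by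
  have hUo := hG.isOpen
  set e : Fin n → ℂ × (Fin n → ℂ) := fun j => (0, Pi.single j 1) with he
  have hdecomp : ∀ y : Fin n → ℂ, ((0 : ℂ), y) = ∑ j, y j • e j := by
    intro y
    refine Prod.ext ?_ ?_
    · simp [he, Prod.fst_sum]
    · rw [Prod.snd_sum]
      simp only [he, Prod.smul_snd]
      exact (pi_eq_sum_univ' y).trans (by simp)
  have hD1 : ∀ v, DifferentiableOn ℂ (fun p => fderiv ℂ G p v) U := fun v =>
    differentiableOn_fderiv_apply hUo hG.holomorphic v
  have hD2 : ∀ v u, DifferentiableOn ℂ (fun p => fderiv ℂ (fun q => fderiv ℂ G q v) p u) U :=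
    fun v u => differentiableOn_fderiv_apply hUo (hD1 v) u
  have hincl : DifferentiableOn ℂ (fun x : ℂ => (x, (0 : Fin n → ℂ))) (Metric.ball 0 r) := by
    fun_prop
  refine ⟨fun i j x => fderiv ℂ G (x, 0) (e j) i,
    fun i j k x => 2⁻¹ * fderiv ℂ (fun q => fderiv ℂ G q (e j)) (x, 0) (e k) i,
    fun i j => differentiableOn_pi.1 ((hD1 (e j)).comp hincl hball) i,
    fun i j k => (differentiableOn_pi.1 ((hD2 (e j) (e k)).comp hincl hball) i).const_mul _,
    fun i j => ?_, fun ρ hρ => ?_⟩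
  · have : fderiv ℂ G ((0 : ℂ), (0 : Fin n → ℂ)) = 0 := hG.deriv_zero.fderiv
    simp [this]
  have hKc : IsCompact ((fun x : ℂ => (x, (0 : Fin n → ℂ))) '' Metric.closedBall 0 ρ) :=
    (isCompact_closedBall 0 ρ).image (by fun_prop)
  have hKU : (fun x : ℂ => (x, (0 : Fin n → ℂ))) '' Metric.closedBall 0 ρ ⊆ U := by
    rintro _ ⟨x, hx, rfl⟩
    exact hball x (Metric.closedBall_subset_ball hρ hx)
  obtain ⟨δ, hδ, hthick⟩ := hKc.exists_cthickening_subset_open hUo hKU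
  have hmem : ∀ x : ℂ, ‖x‖ ≤ ρ → ∀ y : Fin n → ℂ, ‖y‖ ≤ δ → (x, y) ∈ U := by
    intro x hx y hy
    refine hthick (Metric.mem_cthickening_of_dist_le (x, y) (x, 0) δ _
      ⟨x, by simpa using hx, rfl⟩ ?_)
    rw [dist_eq_norm]
    simpa [Prod.norm_def] using hy
  obtain ⟨M, hM⟩ := ((isCompact_closedBall (0 : ℂ) ρ).prod
    (isCompact_closedBall (0 : Fin n → ℂ) δ)).exists_bound_of_continuousOn
    (f := G) (hG.holomorphic.continuousOn.mono fun p hp =>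
      hmem p.1 (by simpa using hp.1) p.2 (by simpa using hp.2))
  have hM' : ∀ x : ℂ, ‖x‖ ≤ ρ → ∀ y : Fin n → ℂ, ‖y‖ ≤ δ → ‖G (x, y)‖ ≤ M := fun x hx y hy =>
    hM (x, y) ⟨by simpa using hx, by simpa using hy⟩
  refine ⟨δ / 2, by positivity, 2 * |M| / δ ^ 3, by positivity, fun x hx y hy =>
    ⟨hmem x hx y (by linarith), fun i => ?_⟩⟩
  have hx0 : (x, (0 : Fin n → ℂ)) ∈ U := hmem x hx 0 (by simpa using hδ.le)
  have hG0 : G (x, 0) = 0 := hG.vanishing x hx0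
  rcases eq_or_ne y 0 with rfl | hy0
  · simp [hG0]
  have hyn : 0 < ‖y‖ := norm_pos_iff.2 hy0
  -- The slice `s ↦ G (x, s • y)` is controlled on the disc of radius `R`. The restriction `‖y‖ ≤ δ
  -- / 2` gives `R ≥ 2`, and the error `2 |M| / R ^ 3` is cubic in `‖y‖`.
  set R := δ / ‖y‖ with hR
  have hR2 : 2 ≤ R := by rw [hR, le_div_iff₀ hyn]; linarith
  have hsy : ∀ s ∈ Metric.closedBall (0 : ℂ) R, ‖s • y‖ ≤ δ := by
    intro s hs
    rw [mem_closedBall_zero_iff, hR, le_div_iff₀ hyn] at hs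
    rwa [norm_smul]
  have hline : ∀ s : ℂ, HasDerivAt (fun s : ℂ => (x, s • y)) ((0 : ℂ), y) s := fun s => by
    simpa using (hasDerivAt_const s x).prodMk ((hasDerivAt_id s).smul_const y)
  have hder : ∀ s ∈ Metric.closedBall (0 : ℂ) R,
      HasDerivAt (fun s : ℂ => G (x, s • y)) (fderiv ℂ G (x, s • y) (0, y)) s := fun s hs =>
    (hG.holomorphic.differentiableAt
      (hUo.mem_nhds (hmem x hx _ (hsy s hs)))).hasFDerivAt.comp_hasDerivAt s (hline s)
  have hdc : DiffContOnCl ℂ (fun s : ℂ => G (x, s • y)) (Metric.ball 0 R) :=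
    DifferentiableOn.diffContOnCl_ball (U := Metric.closedBall 0 R)
      (fun s hs => (hder s hs).differentiableAt.differentiableWithinAt) Subset.rfl
  have hT := norm_taylor_two_le (M := |M|) hR2 hdc fun s hs =>
    (hM' x hx _ (hsy s (Metric.sphere_subset_closedBall hs))).trans (le_abs_self M)
  have hR0 : 0 < R := by linarith
  have hd1 : deriv (fun s : ℂ => G (x, s • y)) =ᶠ[𝓝 0] fun s => fderiv ℂ G (x, s • y) (0, y) :=
    Filter.mem_of_superset (Metric.closedBall_mem_nhds 0 hR0) fun s hs => (hder s hs).deriv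
  have hd2 : deriv (deriv fun s : ℂ => G (x, s • y)) 0 =
      fderiv ℂ (fun q => fderiv ℂ G q (0, y)) (x, 0) (0, y) := by
    rw [hd1.deriv_eq]
    have h1 : HasFDerivAt (fun q => fderiv ℂ G q (0, y))
        (fderiv ℂ (fun q => fderiv ℂ G q (0, y)) (x, 0)) (x, (0 : ℂ) • y) := by
      rw [zero_smul]
      exact ((hD1 (0, y)).differentiableAt (hUo.mem_nhds hx0)).hasFDerivAt
    exact (h1.comp_hasDerivAt 0 (hline 0)).deriv
  rw [hd1.eq_of_nhds, hd2] at hT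
  simp only [zero_smul, one_smul, hG0, zero_add] at hT
  have hL : fderiv ℂ G (x, 0) (0, y) i = ∑ j, fderiv ℂ G (x, 0) (e j) i * y j := by
    rw [hdecomp, map_sum, Finset.sum_apply]
    exact Finset.sum_congr rfl fun j _ => by rw [map_smul, Pi.smul_apply, smul_eq_mul, mul_comm]
  have hQ : fderiv ℂ (fun q => fderiv ℂ G q (0, y)) (x, 0) (0, y) i =
      ∑ j, ∑ k, fderiv ℂ (fun q => fderiv ℂ G q (e j)) (x, 0) (e k) i * y j * y k := by
    have h1 : (fun q => fderiv ℂ G q (0, y)) = fun q => ∑ j, y j • fderiv ℂ G q (e j) := by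
      funext q
      rw [hdecomp, map_sum]
      simp only [map_smul]
    have h2 : ∀ j, DifferentiableAt ℂ (fun q => fderiv ℂ G q (e j)) (x, 0) := fun j =>
      (hD1 (e j)).differentiableAt (hUo.mem_nhds hx0)
    have h3 : fderiv ℂ (fun q => ∑ j, y j • fderiv ℂ G q (e j)) (x, 0) =
        ∑ j, y j • fderiv ℂ (fun q => fderiv ℂ G q (e j)) (x, 0) :=
      (HasFDerivAt.fun_sum fun j _ => (h2 j).hasFDerivAt.const_smul (y j)).fderiv
    rw [h1, h3, _root_.sum_apply,
      Finset.sum_apply]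
    refine Finset.sum_congr rfl fun j _ => ?_
    rw [_root_.smul_apply, hdecomp, map_sum,
      Pi.smul_apply, Finset.sum_apply, smul_eq_mul, Finset.mul_sum]
    exact Finset.sum_congr rfl fun k _ => by
      rw [map_smul, Pi.smul_apply, smul_eq_mul]; ring
  have hTi := (norm_le_pi_norm _ i).trans hT
  rw [Pi.sub_apply, Pi.add_apply, Pi.smul_apply, hL, hQ, smul_eq_mul, Finset.mul_sum] at hTi
  simp only [Finset.mul_sum] at hTi
  refine le_trans (le_of_eq ?_) (hTi.trans (le_of_eq ?_))
  · rw [sub_sub]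
    simp only [mul_assoc]
  · rw [hR, div_pow]; field_simp

end Taylor

/-! ### Semi-invariant 2-jets from a Fuchsian system. -/

section InvariantJet

/-- A solution of a Fuchsian linear system which is holomorphic at the singularity and vanishes
somewhere else vanishes at the singularity. -/
theorem eq_zero_of_fuchsian {ι : Type*} [Fintype ι] {a : ℂ → ι → ℂ} {r K : ℝ} {x₀ : ℂ}
    (hx₀ : x₀ ∈ Metric.ball (0 : ℂ) r) (ha : DifferentiableOn ℂ a (Metric.ball 0 r))
    (hK : ∀ x, ‖x‖ ≤ ‖x₀‖ → ‖x • deriv a x‖ ≤ K * ‖a x‖) (h : a x₀ = 0) : a 0 = 0 := by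
  rw [mem_ball_zero_iff] at hx₀
  have hr : 0 < r := (norm_nonneg _).trans_lt hx₀
  -- On the segment from `x₀` to `0` with logarithmic time, `x ∂ₓ` becomes `-d/dτ`: the singularity
  -- moves to `τ = ∞`, Grönwall gives zero at every finite time, and continuity gives zero in the
  -- limit.
  set c : ℝ → ℂ := fun τ => (Real.exp (-τ) : ℂ) * x₀ with hc
  have hcn : ∀ τ, 0 ≤ τ → ‖c τ‖ ≤ ‖x₀‖ := by
    intro τ hτ
    rw [hc, norm_mul, Complex.norm_real, Real.norm_of_nonneg (Real.exp_pos _).le]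
    exact mul_le_of_le_one_left (norm_nonneg _) (Real.exp_le_one_iff.2 (by linarith))
  have hcd : ∀ τ, HasDerivAt c (-c τ) τ := by
    intro τ
    have h1 : HasDerivAt (fun τ : ℝ => Real.exp (-τ)) (Real.exp (-τ) * -1) τ :=
      (hasDerivAt_neg τ).exp
    have h2 := h1.ofReal_comp.mul_const x₀
    have e : -c τ = ((Real.exp (-τ) * -1 : ℝ) : ℂ) * x₀ := by
      simp only [hc]; push_cast; ring
    rwa [e]
  have hg : ∀ τ, 0 ≤ τ → HasDerivAt (a ∘ c) ((-c τ) • deriv a (c τ)) τ := by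
    intro τ hτ
    have hm : c τ ∈ Metric.ball (0 : ℂ) r := by
      rw [mem_ball_zero_iff]; exact (hcn τ hτ).trans_lt hx₀
    exact (ha.differentiableAt (Metric.isOpen_ball.mem_nhds hm)).hasDerivAt.scomp τ (hcd τ)
  have hzero : ∀ T, 0 ≤ T → a (c T) = 0 := by
    intro T hT
    have := norm_le_gronwallBound_of_norm_deriv_right_le (f := a ∘ c) (δ := 0) (K := K) (ε := 0)
      (a := 0) (b := T) (fun τ hτ => (hg τ hτ.1).continuousAt.continuousWithinAt)
      (fun τ hτ => (hg τ hτ.1).hasDerivWithinAt) (by simp [hc, h])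
      (fun τ hτ => by
        rw [neg_smul, norm_neg, add_zero]
        exact hK _ (hcn τ hτ.1)) T ⟨hT, le_rfl⟩
    rw [gronwallBound_ε0_δ0] at this
    exact norm_le_zero_iff.1 this
  have hlim : Tendsto c atTop (𝓝 0) := by
    have h1 : Tendsto (fun τ : ℝ => (Real.exp (-τ) : ℂ) * x₀) atTop (𝓝 (((0 : ℝ) : ℂ) * x₀)) :=
      ((Complex.continuous_ofReal.tendsto 0).comp
        (Real.tendsto_exp_neg_atTop_nhds_zero)).mul_const x₀
    rwa [Complex.ofReal_zero, zero_mul] at h1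
  have hcont : Tendsto a (𝓝 0) (𝓝 (a 0)) :=
    (ha.differentiableAt (Metric.ball_mem_nhds 0 hr)).continuousAt
  refine tendsto_nhds_unique (hcont.comp hlim) ?_
  refine tendsto_const_nhds.congr' ?_
  filter_upwards [eventually_ge_atTop 0] with τ hτ using (hzero τ hτ).symm

open scoped Matrix.Norms.Operator in
/-- A version of `exists_fuchsian_solution` in coordinates. -/
theorem exists_fuchsian_vector_solution {ι : Type*} [Fintype ι] [DecidableEq ι]
    {M : ι → ι → ℂ → ℂ} {r : ℝ} (hM : ∀ p q, DifferentiableOn ℂ (M p q) (Metric.ball 0 r))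
    (hinj : ∀ (k : ℕ) (v : ι → ℂ), (∀ p, ∑ q, M p q 0 * v q = (k + 1 : ℂ) * v p) → v = 0)
    {v₀ : ι → ℂ} (h0 : ∀ p, ∑ q, M p q 0 * v₀ q = 0) :
    ∃ v : ι → ℂ → ℂ, (∀ p, DifferentiableOn ℂ (v p) (Metric.ball 0 r)) ∧ (∀ p, v p 0 = v₀ p) ∧
      ∀ x ∈ Metric.ball (0 : ℂ) r, ∀ p, x * deriv (v p) x = ∑ q, M p q x * v q x := by
  rcases isEmpty_or_nonempty ι with hι | ⟨⟨o⟩⟩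
  · exact ⟨fun _ _ => 0, fun p => hι.elim p, fun p => hι.elim p, fun _ _ p => hι.elim p⟩
  set N : ℂ → Matrix ι ι ℂ := fun x => Matrix.of fun p q => M p q x with hN
  have hNd : DifferentiableOn ℂ N (Metric.ball 0 r) := by
    have h1 : N = fun x => ∑ p, ∑ q, M p q x • Matrix.single p q (1 : ℂ) := by
      funext x
      rw [Matrix.matrix_eq_sum_single (N x)]
      simp [hN, Matrix.smul_single]
    rw [h1]
    exact DifferentiableOn.fun_sum fun p _ => DifferentiableOn.fun_sum fun q _ =>
      (hM p q).smul_const _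
  have hunit : ∀ k : ℕ, IsUnit (((k + 1 : ℕ) : Matrix ι ι ℂ) - N 0) := by
    intro k
    rw [← Matrix.mulVec_injective_iff_isUnit,
      ← Matrix.coe_mulVecLin, ← LinearMap.ker_eq_bot, LinearMap.ker_eq_bot']
    intro v hv
    refine hinj k v fun p => ?_
    have := congrFun hv p
    rw [Matrix.mulVecLin_apply, Matrix.sub_mulVec, Matrix.natCast_mulVec, Pi.sub_apply,
      Pi.zero_apply, sub_eq_zero] at this
    simpa [Matrix.mulVec, dotProduct, hN] using this.symm
  -- The vector is repeated in every column, so that the matrix-valued existence theorem applies;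
  -- the solution is then read off column `o`.
  have hker : N 0 * Matrix.of (fun p (_ : ι) => v₀ p) = 0 := by
    ext p q
    simpa [Matrix.mul_apply, hN] using h0 p
  obtain ⟨W, hWd, hW0, hW⟩ := exists_fuchsian_solution hNd hunit hker
  have hentry : ∀ x ∈ Metric.ball (0 : ℂ) r, ∀ p,
      HasDerivAt (fun x => W x p o) (deriv W x p o) x := by
    intro x hx p
    exact (LinearMap.toContinuousLinearMap
      (Matrix.entryLinearMap ℂ ℂ p o)).hasFDerivAt.comp_hasDerivAt x
      (hWd.differentiableAt (Metric.isOpen_ball.mem_nhds hx)).hasDerivAt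
  refine ⟨fun p x => W x p o, fun p x hx => (hentry x hx p).differentiableAt.differentiableWithinAt,
    fun p => congrFun (congrFun hW0 p) o, fun x hx p => ?_⟩
  rw [(hentry x hx p).deriv]
  have := congrFun (congrFun (hW x hx) p) o
  rw [Matrix.mul_apply] at this
  exact this

variable {n : ℕ}

/-- Nonresonance gives functions `a · y + b(y, y)`, holomorphic in `x`, on which
the vector field `x ∂ₓ + ∑ (μᵢ yᵢ + ∑ Lᵢⱼ yⱼ + ∑ Qᵢⱼₖ yⱼ yₖ) ∂ᵢ` acts as multiplication by `μ i₀` up to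
terms of order three in `y`. -/
theorem exists_semiinvariant_jet (μ : Fin n → ℂ) (i₀ : Fin n)
    (hμ₁ : ∀ j (k : ℕ), μ i₀ - μ j ≠ k + 1) (hμ₂ : ∀ j l (k : ℕ), μ i₀ - μ j - μ l ≠ k)
    {r : ℝ} {L : Fin n → Fin n → ℂ → ℂ} {Q : Fin n → Fin n → Fin n → ℂ → ℂ}
    (hL : ∀ i j, DifferentiableOn ℂ (L i j) (Metric.ball 0 r))
    (hQ : ∀ i j k, DifferentiableOn ℂ (Q i j k) (Metric.ball 0 r)) (hL0 : ∀ i j, L i j 0 = 0) :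
    ∃ (a : Fin n → ℂ → ℂ) (b : Fin n → Fin n → ℂ → ℂ),
      (∀ j, DifferentiableOn ℂ (a j) (Metric.ball 0 r)) ∧
      (∀ j k, DifferentiableOn ℂ (b j k) (Metric.ball 0 r)) ∧
      (∀ x ∈ Metric.ball (0 : ℂ) r, ∃ j, a j x ≠ 0) ∧
      (∀ x ∈ Metric.ball (0 : ℂ) r, ∀ j,
        x * deriv (a j) x = (μ i₀ - μ j) * a j x - ∑ i, a i x * L i j x) ∧
      ∀ x ∈ Metric.ball (0 : ℂ) r, ∀ j k,
        x * deriv (b j k) x = (μ i₀ - μ j - μ k) * b j k x - ∑ i, b i k x * L i j x -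
          ∑ i, b j i x * L i k x - ∑ i, a i x * Q i j k x := by
  -- The unknowns `a` and `b` form one vector. The equation for `a` does not involve `b`, so `M` is
  -- block triangular, with diagonal blocks that are diagonal at `x = 0` because `L` vanishes there.
  set M : (Fin n ⊕ Fin n × Fin n) → (Fin n ⊕ Fin n × Fin n) → ℂ → ℂ := fun p q x =>
    Sum.elim
      (fun j => Sum.elim (fun i => (if i = j then μ i₀ - μ j else 0) - L i j x) (fun _ => 0) q)
      (fun jk => Sum.elim (fun i => -Q i jk.1 jk.2 x)
        (fun pq => (if pq.1 = jk.1 then (if pq.2 = jk.2 then μ i₀ - μ jk.1 - μ jk.2 else 0) else 0) -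
          (if pq.2 = jk.2 then L pq.1 jk.1 x else 0) -
          (if pq.1 = jk.1 then L pq.2 jk.2 x else 0)) q) p with hM
  have hMl : ∀ x (v : Fin n ⊕ Fin n × Fin n → ℂ) j, ∑ q, M (Sum.inl j) q x * v q =
      (μ i₀ - μ j) * v (Sum.inl j) - ∑ i, v (Sum.inl i) * L i j x := by
    intro x v j
    simp [hM, Fintype.sum_sum_type, sub_mul, Finset.sum_sub_distrib, mul_comm]
  have hMr : ∀ x (v : Fin n ⊕ Fin n × Fin n → ℂ) j k, ∑ q, M (Sum.inr (j, k)) q x * v q =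
      (μ i₀ - μ j - μ k) * v (Sum.inr (j, k)) - ∑ i, v (Sum.inr (i, k)) * L i j x -
          ∑ i, v (Sum.inr (j, i)) * L i k x - ∑ i, v (Sum.inl i) * Q i j k x := by
    intro x v j k
    simp only [hM, Fintype.sum_sum_type, Fintype.sum_prod_type, Sum.elim_inr, Sum.elim_inl, sub_mul,
      Finset.sum_sub_distrib, ite_mul, zero_mul, Finset.sum_ite_eq', Finset.mem_univ, if_true,
      neg_mul, Finset.sum_neg_distrib, Finset.sum_ite_irrel, Finset.sum_const_zero]
    simp only [mul_comm]
    ring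
  have hMd : ∀ p q, DifferentiableOn ℂ (M p q) (Metric.ball 0 r) := by
    rintro (j | ⟨j, k⟩) (i | ⟨p, q⟩)
    · exact (differentiableOn_const _).sub (hL i j)
    · exact differentiableOn_const _
    · exact (hQ i j k).neg
    · refine ((differentiableOn_const _).sub ?_).sub ?_
      · by_cases h : q = k
        · simpa [h] using hL p j
        · simp [h]
      · by_cases h : p = j
        · simpa [h] using hL q k
        · simp [h]
  -- The vector `e_{i₀}` lies in the kernel of the linear block. The quadratic entries solve the
  -- remaining equations at `x = 0`; the denominators are nonzero by `hμ₂` with `k = 0`.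
  set v₀ : Fin n ⊕ Fin n × Fin n → ℂ := Sum.elim (Pi.single i₀ 1)
    fun jk => Q i₀ jk.1 jk.2 0 / (μ i₀ - μ jk.1 - μ jk.2) with hv₀
  have hinj : ∀ (k : ℕ) (v : Fin n ⊕ Fin n × Fin n → ℂ),
      (∀ p, ∑ q, M p q 0 * v q = (k + 1 : ℂ) * v p) → v = 0 := by
    intro k v hv
    have hl : ∀ j, v (Sum.inl j) = 0 := by
      intro j
      have h1 := hv (Sum.inl j)
      rw [hMl] at h1
      simp only [hL0, mul_zero, Finset.sum_const_zero, sub_zero] at h1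
      have h2 : (μ i₀ - μ j - (k + 1)) * v (Sum.inl j) = 0 := by linear_combination h1
      exact (mul_eq_zero.1 h2).resolve_left (sub_ne_zero.2 (hμ₁ j k))
    funext p
    rcases p with j | ⟨j, l⟩
    · exact hl j
    · have h1 := hv (Sum.inr (j, l))
      rw [hMr] at h1
      simp only [hL0, hl, mul_zero, zero_mul, Finset.sum_const_zero, sub_zero] at h1
      have h2 : (μ i₀ - μ j - μ l - (k + 1)) * v (Sum.inr (j, l)) = 0 := by
        linear_combination h1
      refine (mul_eq_zero.1 h2).resolve_left (sub_ne_zero.2 ?_)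
      exact_mod_cast hμ₂ j l (k + 1)
  have hker : ∀ p, ∑ q, M p q 0 * v₀ q = 0 := by
    rintro (j | ⟨j, k⟩)
    · rw [hMl]
      rcases eq_or_ne j i₀ with rfl | hj
      · simp [hL0, hv₀]
      · simp [hL0, hv₀, hj]
    · rw [hMr]
      have hne : μ i₀ - μ j - μ k ≠ 0 := by exact_mod_cast hμ₂ j k 0
      simp [hL0, hv₀, Pi.single_apply]
      field_simp
      simp
  obtain ⟨v, hvd, hv0, hv⟩ := exists_fuchsian_vector_solution hMd hinj hker
  have hvl : ∀ x ∈ Metric.ball (0 : ℂ) r, ∀ j, x * deriv (v (Sum.inl j)) x =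
      (μ i₀ - μ j) * v (Sum.inl j) x - ∑ i, v (Sum.inl i) x * L i j x := fun x hx j => by
    rw [hv x hx, hMl x fun p => v p x]
  refine ⟨fun j => v (Sum.inl j), fun j k => v (Sum.inr (j, k)), fun j => hvd _,
    fun j k => hvd _, fun x₀ hx₀ => ?_, hvl, fun x hx j k => ?_⟩
  · by_contra! hcon
    have hsub : Metric.closedBall (0 : ℂ) ‖x₀‖ ⊆ Metric.ball 0 r :=
      Metric.closedBall_subset_ball (by simpa using hx₀)
    have hB : ∀ i j, ∃ B, ∀ x ∈ Metric.closedBall (0 : ℂ) ‖x₀‖, ‖L i j x‖ ≤ B := fun i j =>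
      (isCompact_closedBall _ _).exists_bound_of_continuousOn ((hL i j).continuousOn.mono hsub)
    choose B hB using hB
    have hB0 : ∀ i j, 0 ≤ B i j := fun i j =>
      (norm_nonneg _).trans (hB i j 0 (by simp))
    -- If all the `aⱼ` vanished at `x₀`, they would vanish at `0`, against `a(0) = e_{i₀}`.
    have hz := eq_zero_of_fuchsian (a := fun x j => v (Sum.inl j) x)
      (K := ∑ j, (‖μ i₀ - μ j‖ + ∑ i, B i j)) hx₀
      (differentiableOn_pi.2 fun j => hvd (Sum.inl j)) (fun x hx => ?_) (funext hcon)
    · have := congrFun hz i₀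
      simp [hv0, hv₀] at this
    · have hx' : x ∈ Metric.closedBall (0 : ℂ) ‖x₀‖ := by simpa using hx
      have hxr := hsub hx'
      have hK0 : 0 ≤ ∑ j, (‖μ i₀ - μ j‖ + ∑ i, B i j) :=
        Finset.sum_nonneg fun j _ => add_nonneg (norm_nonneg _)
          (Finset.sum_nonneg fun i _ => hB0 i j)
      refine (pi_norm_le_iff_of_nonneg (by positivity)).2 fun j => ?_
      have hdp : deriv (fun x j => v (Sum.inl j) x) x = fun j => deriv (v (Sum.inl j)) x :=
        deriv_pi fun j =>
          (hvd (Sum.inl j)).differentiableAt (Metric.isOpen_ball.mem_nhds hxr)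
      rw [hdp, Pi.smul_apply, smul_eq_mul, hvl x hxr]
      have hle : ∀ i, ‖v (Sum.inl i) x‖ ≤ ‖fun j => v (Sum.inl j) x‖ := fun i =>
        norm_le_pi_norm (fun j => v (Sum.inl j) x) i
      calc ‖(μ i₀ - μ j) * v (Sum.inl j) x - ∑ i, v (Sum.inl i) x * L i j x‖
          ≤ ‖μ i₀ - μ j‖ * ‖v (Sum.inl j) x‖ + ∑ i, ‖v (Sum.inl i) x‖ * ‖L i j x‖ := by
            refine (norm_sub_le _ _).trans (add_le_add (norm_mul_le _ _) ?_)
            exact (norm_sum_le _ _).trans (Finset.sum_le_sum fun i _ => norm_mul_le _ _)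
        _ ≤ ‖μ i₀ - μ j‖ * ‖fun j => v (Sum.inl j) x‖ +
              ∑ i, ‖fun j => v (Sum.inl j) x‖ * B i j := by
            refine add_le_add (mul_le_mul_of_nonneg_left (hle j) (norm_nonneg _))
              (Finset.sum_le_sum fun i _ => ?_)
            exact mul_le_mul (hle i) (hB i j x hx') (norm_nonneg _) (norm_nonneg _)
        _ = (‖μ i₀ - μ j‖ + ∑ i, B i j) * ‖fun j => v (Sum.inl j) x‖ := by
            rw [← Finset.mul_sum]; ring
        _ ≤ _ := by
            refine mul_le_mul_of_nonneg_right ?_ (norm_nonneg _)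
            exact Finset.single_le_sum (f := fun j => ‖μ i₀ - μ j‖ + ∑ i, B i j)
              (fun j _ => add_nonneg (norm_nonneg _) (Finset.sum_nonneg fun i _ => hB0 i j))
              (Finset.mem_univ j)
  · rw [hv x hx, hMr x fun p => v p x]

end InvariantJet

/-! ### Grönwall estimates and the algebra of jets along a lift. -/

section Lift

theorem hasDerivWithinAt_Ici_of_Icc {F : Type*} [NormedAddCommGroup F] [NormedSpace ℝ F]
    {η : ℝ → F} {η' : F} {t : ℝ} (ht : t ∈ Ico (0 : ℝ) 1)
    (h : HasDerivWithinAt η η' (Icc 0 1) t) : HasDerivWithinAt η η' (Ici t) t :=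
  h.mono_of_mem_nhdsWithin (Icc_mem_nhdsGE_of_mem ht)

/-- A Grönwall estimate for a differential inequality which is only known near the origin. -/
theorem norm_le_exp_of_local_bound {F : Type*} [NormedAddCommGroup F] [NormedSpace ℝ F]
    {η η' : ℝ → F} {δ K : ℝ} (hK : 0 ≤ K)
    (hη : ∀ t ∈ Icc (0 : ℝ) 1, HasDerivWithinAt η (η' t) (Icc 0 1) t)
    (hb : ∀ t ∈ Icc (0 : ℝ) 1, ‖η t‖ ≤ δ → ‖η' t‖ ≤ K * ‖η t‖)
    (h0 : ‖η 0‖ * Real.exp K < δ) : ∀ t ∈ Icc (0 : ℝ) 1, ‖η t‖ ≤ ‖η 0‖ * Real.exp K := by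
  have hcont : ContinuousOn η (Icc 0 1) := fun t ht => (hη t ht).continuousWithinAt
  have key : ∀ T ∈ Icc (0 : ℝ) 1, (∀ t ∈ Ico 0 T, ‖η t‖ ≤ δ) →
      ‖η T‖ ≤ ‖η 0‖ * Real.exp K := by
    intro T hT hlt
    have := norm_le_gronwallBound_of_norm_deriv_right_le (f := η) (f' := η') (δ := ‖η 0‖) (K := K)
      (ε := 0) (a := 0) (b := T) (hcont.mono (Icc_subset_Icc_right hT.2))
      (fun t ht => hasDerivWithinAt_Ici_of_Icc ⟨ht.1, ht.2.trans_le hT.2⟩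
        (hη t ⟨ht.1, ht.2.le.trans hT.2⟩)) le_rfl
      (fun t ht => by
        rw [add_zero]; exact hb t ⟨ht.1, ht.2.le.trans hT.2⟩ (hlt t ht)) T ⟨hT.1, le_rfl⟩
    rw [gronwallBound_ε0, sub_zero] at this
    refine this.trans ?_
    gcongr
    exact mul_le_of_le_one_right hK hT.2
  have hlt : ∀ t ∈ Icc (0 : ℝ) 1, ‖η t‖ < δ := by
    by_contra! hcon
    obtain ⟨t₀, ht₀, hδ⟩ := hcon
    have hclosed : IsCompact (Icc (0 : ℝ) 1 ∩ (fun t => ‖η t‖) ⁻¹' Ici δ) :=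
      isCompact_Icc.of_isClosed_subset (hcont.norm.preimage_isClosed_of_isClosed isClosed_Icc
        isClosed_Ici) inter_subset_left
    -- At the first time `T` with `‖η T‖ ≥ δ` the differential inequality has held on all of `[0,
    -- T)`, so `key` already forces `‖η T‖ < δ`.
    obtain ⟨T, hT, hmin⟩ := hclosed.exists_isLeast ⟨t₀, ht₀, hδ⟩
    have h1 : ∀ t ∈ Ico 0 T, ‖η t‖ ≤ δ := by
      intro t ht
      by_contra! hgt
      exact absurd (hmin ⟨⟨ht.1, ht.2.le.trans hT.1.2⟩, hgt.le⟩) (not_le.2 ht.2)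
    exact absurd ((key T hT.1 h1).trans_lt h0) (not_lt.2 hT.2)
  exact fun t ht => key t ht fun s hs => (hlt s ⟨hs.1, hs.2.le.trans ht.2⟩).le

/-- Stability of the linear equation `u' = c(t) κ u` under perturbations. -/
theorem exists_norm_sub_exp_mul_le {c : ℝ → ℂ} (hc : ContinuousOn c (Icc 0 1)) (κ : ℂ) :
    ∃ K ≥ 0, ∀ (u R : ℝ → ℂ) (ε : ℝ), (∀ t ∈ Icc (0 : ℝ) 1, ‖R t‖ ≤ ε) →
      (∀ t ∈ Icc (0 : ℝ) 1, HasDerivWithinAt u (c t * (κ * u t + R t)) (Icc 0 1) t) →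
      ‖u 1 - Complex.exp (κ * ∫ t in (0 : ℝ)..1, c t) * u 0‖ ≤ K * ε := by
  set d : ℝ → ℂ := IccExtend (zero_le_one' ℝ) ((Icc (0 : ℝ) 1).domRestrict c) with hd
  have hdc : Continuous d := (continuousOn_iff_continuous_domRestrict.1 hc).Icc_extend'
  have hdeq : ∀ t ∈ Icc (0 : ℝ) 1, d t = c t := fun t ht => by
    rw [hd, IccExtend_of_mem _ _ ht]; rfl
  set J : ℝ → ℂ := fun t => ∫ s in (0 : ℝ)..t, d s with hJ
  have hJd : ∀ t, HasDerivAt J (d t) t := fun t => hdc.integral_hasStrictDerivAt 0 t |>.hasDerivAt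
  have hJ1 : J 1 = ∫ t in (0 : ℝ)..1, c t := by
    refine intervalIntegral.integral_congr fun t ht => hdeq t ?_
    rwa [uIcc_of_le zero_le_one] at ht
  have hJ0 : J 0 = 0 := by simp [hJ]
  have hE : ∀ t, HasDerivAt (fun t => Complex.exp (-(κ * J t)))
      (Complex.exp (-(κ * J t)) * -(κ * d t)) t := fun t => ((hJd t).const_mul κ).neg.cexp
  have hEc : Continuous fun t => Complex.exp (-(κ * J t)) :=
    continuous_iff_continuousAt.2 fun t => (hE t).continuousAt
  obtain ⟨B, hB⟩ := isCompact_Icc.exists_bound_of_continuousOn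
    (hEc.mul hdc).continuousOn (s := Icc (0 : ℝ) 1)
  have hB0 : 0 ≤ B := (norm_nonneg _).trans (hB 0 (by simp))
  refine ⟨‖Complex.exp (κ * J 1)‖ * B, by positivity, fun u R ε hR hu => ?_⟩
  -- The integrating factor removes the homogeneous part, leaving only the perturbation `R`.
  have hv : ∀ t ∈ Icc (0 : ℝ) 1, HasDerivWithinAt (fun t => Complex.exp (-(κ * J t)) * u t)
      (Complex.exp (-(κ * J t)) * d t * R t) (Icc 0 1) t := by
    intro t ht
    refine ((hE t).hasDerivWithinAt.mul (hu t ht)).congr_deriv ?_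
    rw [hdeq t ht]; ring
  have hmain := norm_image_sub_le_of_norm_deriv_le_segment' (C := B * ε) hv
    (fun t ht => by
      have ht' : t ∈ Icc (0 : ℝ) 1 := ⟨ht.1, ht.2.le⟩
      rw [norm_mul]
      exact mul_le_mul (hB t ht') (hR t ht') (norm_nonneg _) hB0) 1 ⟨zero_le_one, le_rfl⟩
  simp only [hJ0, mul_zero, neg_zero, Complex.exp_zero, one_mul, sub_zero, mul_one] at hmain
  rw [← hJ1]
  have e : u 1 - Complex.exp (κ * J 1) * u 0 =
      Complex.exp (κ * J 1) * (Complex.exp (-(κ * J 1)) * u 1 - u 0) := by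
    rw [mul_sub, ← mul_assoc, ← Complex.exp_add]; simp
  rw [e, norm_mul, mul_assoc]
  gcongr

variable {n : ℕ}

/-- The value at `y` of the polynomial `a · y + b(y, y)`. -/
def quadraticPoly (a : Fin n → ℂ) (b : Fin n → Fin n → ℂ) (y : Fin n → ℂ) : ℂ :=
  ∑ j, a j * y j + ∑ j, ∑ k, b j k * y j * y k

/-- The terms of degree at most two cancel when the derivative along `μ η + L η + Q(η, η) + R` of a
semi-invariant jet is computed. -/
theorem semiinvariant_jet_identity (κ : ℂ) (μ a a' η R V : Fin n → ℂ)
    (b b' L : Fin n → Fin n → ℂ) (Q : Fin n → Fin n → Fin n → ℂ)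
    (ha' : ∀ j, a' j = (κ - μ j) * a j - ∑ i, a i * L i j)
    (hb' : ∀ j k, b' j k = (κ - μ j - μ k) * b j k - ∑ i, b i k * L i j -
      ∑ i, b j i * L i k - ∑ i, a i * Q i j k)
    (hV : ∀ i, V i = μ i * η i + ∑ j, L i j * η j + ∑ j, ∑ k, Q i j k * η j * η k + R i) :
    ∑ j, (a' j * η j + a j * V j) +
        ∑ j, ∑ k, (b' j k * η j * η k + b j k * (V j * η k + η j * V k)) =
      κ * quadraticPoly a b η + (∑ j, a j * R j + ∑ j, ∑ k, b j k *
        ((∑ p, ∑ q, Q j p q * η p * η q + R j) * η k +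
          η j * (∑ p, ∑ q, Q k p q * η p * η q + R k))) := by
  -- `A1` to `A4` move the action of `L` and `Q` on the coefficients over to `η`: `L` on `a`, on
  -- either slot of `b`, and `Q` on `a`. These are the terms that cancel in the end.
  have A1 : ∑ j, (∑ i, a i * L i j) * η j = ∑ i, a i * ∑ j, L i j * η j := by
    simp only [Finset.sum_mul, Finset.mul_sum]
    rw [Finset.sum_comm]
    simp only [mul_assoc]
  have A2 : ∑ j, ∑ k, (∑ i, b i k * L i j) * η j * η k =
      ∑ j, ∑ k, b j k * ((∑ i, L j i * η i) * η k) := by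
    simp only [Finset.sum_mul, Finset.mul_sum]
    rw [Finset.sum_comm, Finset.sum_comm (s := Finset.univ) (t := Finset.univ)
      (f := fun j k => ∑ i, b j k * (L j i * η i * η k))]
    refine Finset.sum_congr rfl fun k _ => ?_
    rw [Finset.sum_comm]
    exact Finset.sum_congr rfl fun i _ => Finset.sum_congr rfl fun j _ => by ring
  have A3 : ∑ j, ∑ k, (∑ i, b j i * L i k) * η j * η k =
      ∑ j, ∑ k, b j k * (η j * ∑ i, L k i * η i) := by
    simp only [Finset.sum_mul, Finset.mul_sum]
    refine Finset.sum_congr rfl fun j _ => ?_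
    rw [Finset.sum_comm]
    exact Finset.sum_congr rfl fun i _ => Finset.sum_congr rfl fun k _ => by ring
  have A4 : ∑ j, ∑ k, (∑ i, a i * Q i j k) * η j * η k =
      ∑ i, a i * ∑ j, ∑ k, Q i j k * η j * η k := by
    simp only [Finset.sum_mul, Finset.mul_sum]
    rw [Finset.sum_congr rfl fun j _ => Finset.sum_comm, Finset.sum_comm]
    exact Finset.sum_congr rfl fun i _ => Finset.sum_congr rfl fun j _ =>
      Finset.sum_congr rfl fun k _ => by ring
  have B1 : ∀ j, a' j * η j + a j * V j = κ * (a j * η j) - (∑ i, a i * L i j) * η j +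
      a j * (∑ i, L j i * η i) + a j * (∑ p, ∑ q, Q j p q * η p * η q) + a j * R j := fun j => by
    rw [ha', hV]; ring
  have B2 : ∀ j k, b' j k * η j * η k + b j k * (V j * η k + η j * V k) =
      κ * (b j k * η j * η k) - (∑ i, b i k * L i j) * η j * η k -
        (∑ i, b j i * L i k) * η j * η k - (∑ i, a i * Q i j k) * η j * η k +
        b j k * ((∑ i, L j i * η i) * η k) + b j k * (η j * ∑ i, L k i * η i) +
        b j k * ((∑ p, ∑ q, Q j p q * η p * η q + R j) * η k +
          η j * (∑ p, ∑ q, Q k p q * η p * η q + R k)) := fun j k => by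
    rw [hb', hV, hV]; ring
  rw [Finset.sum_congr rfl fun j _ => B1 j,
    Finset.sum_congr rfl fun j _ => Finset.sum_congr rfl fun k _ => B2 j k]
  simp only [Finset.sum_add_distrib, Finset.sum_sub_distrib, ← Finset.mul_sum, quadraticPoly]
  linear_combination -A1 - A2 - A3 - A4

end Lift

/-! ### Approximate semi-invariance under the holonomy. -/

section Holonomy

variable {n : ℕ}

/-- A lift of a loop to the leaves of `vectorField A G` solves the nonautonomous equation
`η' = (γ' / γ) (A η + G(γ, η))`. -/
theorem IsLeafLift.hasDerivWithinAt {A : Matrix (Fin n) (Fin n) ℂ} {U : Set (ℂ × (Fin n → ℂ))}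
    {G : ℂ × (Fin n → ℂ) → (Fin n → ℂ)} {γ : ℝ → ℂ} {w : ℝ → ℂ × (Fin n → ℂ)}
    (hγ : ∀ t ∈ Icc (0 : ℝ) 1, γ t ≠ 0) (hw : IsLeafLift U (vectorField A G) γ w) {t : ℝ}
    (ht : t ∈ Icc (0 : ℝ) 1) :
    HasDerivWithinAt γ (derivWithin γ (Icc 0 1) t / γ t * γ t) (Icc 0 1) t ∧
      HasDerivWithinAt (fun s => (w s).2) ((derivWithin γ (Icc 0 1) t / γ t) •
        (A.mulVec (w t).2 + G (γ t, (w t).2))) (Icc 0 1) t := by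
  obtain ⟨-, hfst, c, hc⟩ := hw t ht
  have h1 : HasDerivWithinAt (fun s => (w s).1) (c * (w t).1) (Icc 0 1) t :=
    (ContinuousLinearMap.fst ℝ ℂ (Fin n → ℂ)).hasFDerivAt.comp_hasDerivWithinAt t hc
  have h2 : HasDerivWithinAt (fun s => (w s).2) (c • (A.mulVec (w t).2 + G (w t))) (Icc 0 1) t :=
    (ContinuousLinearMap.snd ℝ ℂ (Fin n → ℂ)).hasFDerivAt.comp_hasDerivWithinAt t hc
  rw [hfst] at h1
  have h3 : HasDerivWithinAt γ (c * γ t) (Icc 0 1) t :=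
    h1.congr (fun s hs => (hw s hs).2.1.symm) hfst.symm
  -- The first component of the field is `x`, so lying over `γ` determines the leafwise speed.
  have hceq : derivWithin γ (Icc 0 1) t / γ t = c := by
    rw [h3.derivWithin (uniqueDiffOn_Icc zero_lt_one t ht), mul_div_cancel_right₀ _ (hγ t ht)]
  have hwt : w t = (γ t, (w t).2) := Prod.ext hfst rfl
  rw [hceq, ← hwt]
  exact ⟨h3, h2⟩

theorem exists_uniform_bound {ι : Type*} [Fintype ι] {F : ι → ℂ → ℂ} {K : Set ℂ}
    (hK : IsCompact K) (hF : ∀ i, ContinuousOn (F i) K) :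
    ∃ B ≥ 0, ∀ x ∈ K, ∀ i, ‖F i x‖ ≤ B := by
  obtain ⟨B, hB⟩ := hK.exists_bound_of_continuousOn (f := fun x i => F i x)
    (continuousOn_pi.2 hF)
  exact ⟨|B|, abs_nonneg B, fun x hx i =>
    (norm_le_pi_norm (fun i => F i x) i).trans ((hB x hx).trans (le_abs_self B))⟩

theorem norm_sum_le_card_mul {ι : Type*} [Fintype ι] {z : ι → ℂ} {B : ℝ} (hB : ∀ i, ‖z i‖ ≤ B) :
    ‖∑ i, z i‖ ≤ Fintype.card ι * B := by
  simpa using norm_sum_le_of_le Finset.univ fun i _ => hB i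

/-- If `μ i₀` is nonresonant, up to order two and with respect to natural numbers, then the
holonomy multiplies some function `a · y + b(y, y)`, `a ≠ 0`, on the transversal
by `exp (2πi μ i₀)`, up to terms of order three. -/
theorem IsHolonomy.exists_semiinvariant {μ : Fin n → ℂ} {i₀ : Fin n}
    (hμ₁ : ∀ j (k : ℕ), μ i₀ - μ j ≠ k + 1) (hμ₂ : ∀ j l (k : ℕ), μ i₀ - μ j - μ l ≠ k)
    {U : Set (ℂ × (Fin n → ℂ))} {G : ℂ × (Fin n → ℂ) → (Fin n → ℂ)} {γ : ℝ → ℂ}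
    {f : (Fin n → ℂ) → (Fin n → ℂ)} (hG : IsAdmissible U G) (hγ : IsPositiveSimpleLoop γ)
    (hf : IsHolonomy U (vectorField (Matrix.diagonal μ) G) γ f) :
    ∃ (a : Fin n → ℂ) (b : Fin n → Fin n → ℂ) (K : ℝ), a ≠ 0 ∧
      ∀ᶠ y in 𝓝 (0 : Fin n → ℂ), ‖f y‖ ≤ K * ‖y‖ ∧
        ‖quadraticPoly a b (f y) - Complex.exp (2 * Real.pi * Complex.I * μ i₀) *
          quadraticPoly a b y‖ ≤ K * ‖y‖ ^ 3 := by
  obtain ⟨⟨r, hγr, hball⟩, hlift⟩ := hf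
  have hγc : ContinuousOn γ (Icc 0 1) := hγ.contDiffOn.continuousOn
  -- The coefficients are holomorphic only on the open disc; uniform bounds need a smaller closed
  -- disc, which still contains the compact loop.
  obtain ⟨ρ, hρr, hγρ⟩ : ∃ ρ < r, ∀ t ∈ Icc (0 : ℝ) 1, ‖γ t‖ ≤ ρ := by
    obtain ⟨t₀, ht₀, hmax⟩ := isCompact_Icc.exists_isMaxOn ⟨0, by simp⟩ hγc.norm
    exact ⟨‖γ t₀‖, by simpa using hγr t₀ ht₀, fun t ht => hmax ht⟩
  obtain ⟨L, Q, hLd, hQd, hL0, hjet⟩ := hG.exists_transverse_jet hball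
  obtain ⟨δ, hδ, C, hC, hjet⟩ := hjet ρ hρr
  obtain ⟨a, b, had, hbd, hane, haeq, hbeq⟩ := exists_semiinvariant_jet μ i₀ hμ₁ hμ₂ hLd hQd hL0
  have hsub : Metric.closedBall (0 : ℂ) ρ ⊆ Metric.ball 0 r := Metric.closedBall_subset_ball hρr
  have hcpt : IsCompact (Metric.closedBall (0 : ℂ) ρ) := isCompact_closedBall 0 ρ
  obtain ⟨Ba, hBa0, hBa⟩ := exists_uniform_bound hcpt fun j => (had j).continuousOn.mono hsub
  obtain ⟨Bb, hBb0, hBb⟩ := exists_uniform_bound hcpt fun p : Fin n × Fin n =>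
    (hbd p.1 p.2).continuousOn.mono hsub
  obtain ⟨BL, hBL0, hBL⟩ := exists_uniform_bound hcpt fun p : Fin n × Fin n =>
    (hLd p.1 p.2).continuousOn.mono hsub
  obtain ⟨BQ, hBQ0, hBQ⟩ := exists_uniform_bound hcpt fun p : Fin n × Fin n × Fin n =>
    (hQd p.1 p.2.1 p.2.2).continuousOn.mono hsub
  have hγmem : ∀ t ∈ Icc (0 : ℝ) 1, γ t ∈ Metric.closedBall (0 : ℂ) ρ := fun t ht => by
    simpa using hγρ t ht
  set c : ℝ → ℂ := fun t => derivWithin γ (Icc 0 1) t / γ t with hc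
  have hcc : ContinuousOn c (Icc 0 1) :=
    (hγ.contDiffOn.continuousOn_derivWithin (uniqueDiffOn_Icc zero_lt_one) le_rfl).div hγc hγ.ne_zero
  obtain ⟨Bc, hBc⟩ := isCompact_Icc.exists_bound_of_continuousOn hcc
  have hBc0 : 0 ≤ Bc := (norm_nonneg _).trans (hBc 0 (by simp))
  obtain ⟨K₂, hK₂0, hK₂⟩ := exists_norm_sub_exp_mul_le hcc (μ i₀)
  -- estimates of the terms of the vector field at a point `(x, η)`, `‖x‖ ≤ ρ`
  have hq : ∀ x ∈ Metric.closedBall (0 : ℂ) ρ, ∀ η : Fin n → ℂ, ∀ i,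
      ‖∑ j, ∑ k, Q i j k x * η j * η k‖ ≤ n * (n * (BQ * ‖η‖ ^ 2)) := by
    intro x hx η i
    refine (norm_sum_le_card_mul fun j => norm_sum_le_card_mul (B := BQ * ‖η‖ ^ 2) fun k => ?_).trans
      (by simp)
    rw [norm_mul, norm_mul, mul_assoc, sq]
    exact mul_le_mul (hBQ x hx (i, j, k)) (mul_le_mul (norm_le_pi_norm η j) (norm_le_pi_norm η k)
      (norm_nonneg _) (norm_nonneg _)) (by positivity) hBQ0
  have hl : ∀ x ∈ Metric.closedBall (0 : ℂ) ρ, ∀ η : Fin n → ℂ, ∀ i,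
      ‖∑ j, L i j x * η j‖ ≤ n * (BL * ‖η‖) := by
    intro x hx η i
    refine (norm_sum_le_card_mul (B := BL * ‖η‖) fun j => ?_).trans (by simp)
    rw [norm_mul]
    exact mul_le_mul (hBL x hx (i, j)) (norm_le_pi_norm η j) (norm_nonneg _) hBL0
  set R : ℂ → (Fin n → ℂ) → Fin n → ℂ := fun x η i =>
    G (x, η) i - ∑ j, L i j x * η j - ∑ j, ∑ k, Q i j k x * η j * η k with hR
  have hRb : ∀ x ∈ Metric.closedBall (0 : ℂ) ρ, ∀ η : Fin n → ℂ, ‖η‖ ≤ δ → ∀ i,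
      ‖R x η i‖ ≤ C * ‖η‖ ^ 3 := fun x hx η hη i =>
    (hjet x (by simpa using hx) η hη).2 i
  set D : ℝ := n * (n * BQ) + C with hD
  have hD0 : 0 ≤ D := by positivity
  have hqR : ∀ x ∈ Metric.closedBall (0 : ℂ) ρ, ∀ η : Fin n → ℂ, ‖η‖ ≤ δ → ‖η‖ ≤ 1 → ∀ i,
      ‖∑ j, ∑ k, Q i j k x * η j * η k + R x η i‖ ≤ D * ‖η‖ ^ 2 := by
    intro x hx η hη hη1 i
    refine (norm_add_le _ _).trans ((add_le_add (hq x hx η i) (hRb x hx η hη i)).trans ?_)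
    have : ‖η‖ ^ 3 ≤ ‖η‖ ^ 2 := pow_le_pow_of_le_one (norm_nonneg _) hη1 (by norm_num)
    rw [hD]
    nlinarith
  set K₁ : ℝ := ‖μ‖ + n * BL + D with hK₁
  have hK₁0 : 0 ≤ K₁ := by positivity
  have hV : ∀ x ∈ Metric.closedBall (0 : ℂ) ρ, ∀ η : Fin n → ℂ, ‖η‖ ≤ δ → ‖η‖ ≤ 1 →
      ‖(Matrix.diagonal μ).mulVec η + G (x, η)‖ ≤ K₁ * ‖η‖ := by
    intro x hx η hη hη1
    refine (pi_norm_le_iff_of_nonneg (by positivity)).2 fun i => ?_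
    have e : ((Matrix.diagonal μ).mulVec η + G (x, η)) i = μ i * η i + ∑ j, L i j x * η j +
        (∑ j, ∑ k, Q i j k x * η j * η k + R x η i) := by
      rw [Pi.add_apply, Matrix.mulVec_diagonal]; simp only [hR]; ring
    have h2 : D * ‖η‖ ^ 2 ≤ D * ‖η‖ :=
      mul_le_mul_of_nonneg_left (pow_le_of_le_one (norm_nonneg _) hη1 two_ne_zero) hD0
    have h3 : ‖μ i * η i‖ ≤ ‖μ‖ * ‖η‖ := by
      rw [norm_mul]
      exact mul_le_mul (norm_le_pi_norm μ i) (norm_le_pi_norm η i) (norm_nonneg _) (norm_nonneg _)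
    rw [e]
    refine (norm_add₃_le).trans ((add_le_add_three h3 (hl x hx η i)
      ((hqR x hx η hη hη1 i).trans h2)).trans (le_of_eq ?_))
    rw [hK₁]; ring
  -- This is the remainder in `semiinvariant_jet_identity`: `R` is cubic, and the quadratic part of
  -- the field enters multiplied by another factor `η`.
  set T : ℂ → (Fin n → ℂ) → ℂ := fun x η => ∑ j, a j x * R x η j + ∑ j, ∑ k, b j k x *
    ((∑ p, ∑ q, Q j p q x * η p * η q + R x η j) * η k +
      η j * (∑ p, ∑ q, Q k p q x * η p * η q + R x η k)) with hT
  set K₃ : ℝ := n * (Ba * C) + n * (n * (Bb * (2 * D))) with hK₃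
  have hK₃0 : 0 ≤ K₃ := by positivity
  have hTb : ∀ x ∈ Metric.closedBall (0 : ℂ) ρ, ∀ η : Fin n → ℂ, ‖η‖ ≤ δ → ‖η‖ ≤ 1 →
      ‖T x η‖ ≤ K₃ * ‖η‖ ^ 3 := by
    intro x hx η hη hη1
    have h1 : ‖∑ j, a j x * R x η j‖ ≤ n * (Ba * (C * ‖η‖ ^ 3)) := by
      refine (norm_sum_le_card_mul (B := Ba * (C * ‖η‖ ^ 3)) fun j => ?_).trans (by simp)
      rw [norm_mul]
      exact mul_le_mul (hBa x hx j) (hRb x hx η hη j) (norm_nonneg _) hBa0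
    refine (norm_add_le _ _).trans ((add_le_add h1 ((norm_sum_le_card_mul fun j =>
      norm_sum_le_card_mul (B := Bb * (D * ‖η‖ ^ 2 * ‖η‖ + ‖η‖ * (D * ‖η‖ ^ 2))) fun k =>
        ?_).trans le_rfl)).trans (le_of_eq ?_))
    · rw [norm_mul]
      refine mul_le_mul (hBb x hx (j, k)) ((norm_add_le _ _).trans ?_) (norm_nonneg _) hBb0
      rw [norm_mul, norm_mul]
      exact add_le_add
        (mul_le_mul (hqR x hx η hη hη1 j) (norm_le_pi_norm η k) (norm_nonneg _) (by positivity))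
        (mul_le_mul (norm_le_pi_norm η j) (hqR x hx η hη hη1 k) (norm_nonneg _) (norm_nonneg _))
    · rw [hK₃, Fintype.card_fin]; ring
  set E : ℝ := Real.exp (Bc * K₁) with hE
  have hE0 : 0 < E := Real.exp_pos _
  have h0mem : (0 : ℝ) ∈ Icc (0 : ℝ) 1 := by simp
  have h1mem : (1 : ℝ) ∈ Icc (0 : ℝ) 1 := by simp
  refine ⟨fun j => a j (γ 0), fun j k => b j k (γ 0), max E (K₂ * (K₃ * E ^ 3)), ?_, ?_⟩
  · obtain ⟨j, hj⟩ := hane (γ 0) (hγr 0 h0mem)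
    exact fun h => hj (congrFun h j)
  have hsmall : ∀ᶠ y in 𝓝 (0 : Fin n → ℂ), ‖y‖ * E < min δ 1 := by
    have : Continuous fun y : Fin n → ℂ => ‖y‖ * E := by fun_prop
    exact this.continuousAt.eventually_lt continuousAt_const (by simpa using hδ)
  filter_upwards [hlift, hsmall] with y ⟨w, hw, hw0, hw1⟩ hy
  set η : ℝ → Fin n → ℂ := fun t => (w t).2 with hη
  have hη0 : η 0 = y := by simp [hη, hw0]
  have hη1 : η 1 = f y := by simp [hη, hw1]
  have hder := fun t (ht : t ∈ Icc (0 : ℝ) 1) => hw.hasDerivWithinAt hγ.ne_zero ht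
  have hηb : ∀ t ∈ Icc (0 : ℝ) 1, ‖η t‖ ≤ ‖y‖ * E := by
    have := norm_le_exp_of_local_bound (η := η) (δ := min δ 1) (K := Bc * K₁) (by positivity)
      (fun t ht => (hder t ht).2) (fun t ht hηt => by
        rw [norm_smul, mul_assoc]
        exact mul_le_mul (hBc t ht) (hV (γ t) (hγmem t ht) (η t) (hηt.trans (min_le_left _ _))
          (hηt.trans (min_le_right _ _))) (norm_nonneg _) hBc0) (by rwa [hη0])
    rwa [hη0] at this
  have hηδ : ∀ t ∈ Icc (0 : ℝ) 1, ‖η t‖ ≤ δ ∧ ‖η t‖ ≤ 1 := fun t ht =>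
    ⟨((hηb t ht).trans hy.le).trans (min_le_left _ _),
      ((hηb t ht).trans hy.le).trans (min_le_right _ _)⟩
  set u : ℝ → ℂ := fun t => quadraticPoly (fun j => a j (γ t)) (fun j k => b j k (γ t)) (η t)
    with hu
  set V : ℝ → Fin n → ℂ := fun t => (Matrix.diagonal μ).mulVec (η t) + G (γ t, η t) with hVdef
  have hud : ∀ t ∈ Icc (0 : ℝ) 1,
      HasDerivWithinAt u (c t * (μ i₀ * u t + T (γ t) (η t))) (Icc 0 1) t := by
    intro t ht
    have hγt := hsub (hγmem t ht)
    have hcomp : ∀ g : ℂ → ℂ, DifferentiableOn ℂ g (Metric.ball 0 r) →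
        HasDerivWithinAt (fun t => g (γ t)) (c t * (γ t * deriv g (γ t))) (Icc 0 1) t := by
      intro g hg
      have h1 := (hg.differentiableAt (Metric.isOpen_ball.mem_nhds hγt)).hasDerivAt
      refine (h1.comp_hasDerivWithinAt t (hder t ht).1).congr_deriv ?_
      simp only [hc]; ring
    have hηd : ∀ j, HasDerivWithinAt (fun t => η t j) (c t * V t j) (Icc 0 1) t := fun j =>
      hasDerivWithinAt_pi.1 (hder t ht).2 j
    have hid := semiinvariant_jet_identity (μ i₀) μ (fun j => a j (γ t))
      (fun j => γ t * deriv (a j) (γ t)) (η t) (R (γ t) (η t)) (V t) (fun j k => b j k (γ t))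
      (fun j k => γ t * deriv (b j k) (γ t)) (fun i j => L i j (γ t))
      (fun i j k => Q i j k (γ t)) (haeq _ hγt) (hbeq _ hγt) (fun i => by
        simp only [hVdef, hR, Pi.add_apply, Matrix.mulVec_diagonal]; ring)
    have hsum := (HasDerivWithinAt.fun_sum (u := Finset.univ) fun j _ =>
      (hcomp (a j) (had j)).mul (hηd j)).add (HasDerivWithinAt.fun_sum (u := Finset.univ)
        fun j _ => HasDerivWithinAt.fun_sum (u := Finset.univ) fun k _ =>
          ((hcomp (b j k) (hbd j k)).mul (hηd j)).mul (hηd k))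
    refine hsum.congr_deriv ?_
    rw [← hid, mul_add, Finset.mul_sum, Finset.mul_sum]
    refine congrArg₂ _ (Finset.sum_congr rfl fun j _ => by ring)
      (Finset.sum_congr rfl fun j _ => ?_)
    rw [Finset.mul_sum]
    exact Finset.sum_congr rfl fun k _ => by simp only [Pi.mul_apply]; ring
  have hTt : ∀ t ∈ Icc (0 : ℝ) 1, ‖T (γ t) (η t)‖ ≤ K₃ * (‖y‖ * E) ^ 3 := by
    intro t ht
    refine (hTb (γ t) (hγmem t ht) (η t) (hηδ t ht).1 (hηδ t ht).2).trans ?_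
    gcongr
    exact hηb t ht
  have hfin := hK₂ u (fun t => T (γ t) (η t)) _ hTt hud
  -- The index condition turns `exp (μ i₀ ∫ γ'/γ)` into `exp (2πi μ i₀)`. Closedness of `γ`, used
  -- for `hu1`, ensures that both ends of the lift are evaluated with the same polynomial.
  rw [hγ.index_one] at hfin
  have hu0 : u 0 = quadraticPoly (fun j => a j (γ 0)) (fun j k => b j k (γ 0)) y := by
    simp only [hu, hη0]
  have hu1 : u 1 = quadraticPoly (fun j => a j (γ 0)) (fun j k => b j k (γ 0)) (f y) := by
    simp only [hu, hη1, hγ.closed]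
  rw [hu0, hu1, mul_comm (μ i₀)] at hfin
  constructor
  · rw [← hη1]
    refine (hηb 1 h1mem).trans ?_
    rw [mul_comm]
    gcongr
    exact le_max_left _ _
  · refine hfin.trans ?_
    calc K₂ * (K₃ * (‖y‖ * E) ^ 3) = K₂ * (K₃ * E ^ 3) * ‖y‖ ^ 3 := by ring
      _ ≤ _ := by gcongr; exact le_max_right _ _

end Holonomy

/-! ### The germ `h` and the contradiction from its resonant monomial. -/

section Example

open Asymptotics

theorem exp_two_pi_I_mul_neg_three_halves :
    Complex.exp (2 * Real.pi * Complex.I * (-3 / 2)) = -1 := by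
  rw [show (2 * Real.pi * Complex.I * (-3 / 2) : ℂ) =
    -(Real.pi * Complex.I) - 2 * Real.pi * Complex.I by ring, Complex.exp_sub,
    Complex.exp_two_pi_mul_I, Complex.exp_neg, Complex.exp_pi_mul_I]
  norm_num

theorem exp_two_pi_I_mul_neg_one_quarter :
    Complex.exp (2 * Real.pi * Complex.I * (-1 / 4)) = -Complex.I := by
  rw [show (2 * Real.pi * Complex.I * (-1 / 4) : ℂ) = -(Real.pi / 2 * Complex.I) by ring,
    Complex.exp_neg, Complex.exp_pi_div_two_mul_I, Complex.inv_I]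

variable {h : (Fin 2 → ℂ) → (Fin 2 → ℂ)}

theorem analyticAt_vec_two {F₀ F₁ : (Fin 2 → ℂ) → ℂ} {y : Fin 2 → ℂ} (h₀ : AnalyticAt ℂ F₀ y)
    (h₁ : AnalyticAt ℂ F₁ y) : AnalyticAt ℂ (fun z => ![F₀ z, F₁ z]) y := by
  rw [analyticAt_pi_iff]
  intro i
  fin_cases i
  · simpa using h₀
  · simpa using h₁

theorem analyticAt_coord (i : Fin 2) (y : Fin 2 → ℂ) :
    AnalyticAt ℂ (fun z : Fin 2 → ℂ => z i) y :=
  (ContinuousLinearMap.proj (R := ℂ) (φ := fun _ : Fin 2 => ℂ) i).analyticAt y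

theorem isDiffGerm_of_eq (hh : ∀ y, h y = ![-y 0 + y 1 ^ 2, -Complex.I * y 1]) :
    IsDiffGerm h := by
  obtain rfl : h = fun y => ![-y 0 + y 1 ^ 2, -Complex.I * y 1] := funext hh
  have c := fun i => analyticAt_coord i 0
  refine ⟨by simp, analyticAt_vec_two ((c 0).neg.add ((c 1).pow 2)) (analyticAt_const.mul (c 1)),
    fun z => ![-z 0 - z 1 ^ 2, Complex.I * z 1], by simp,
    analyticAt_vec_two ((c 0).neg.sub ((c 1).pow 2)) (analyticAt_const.mul (c 1)),
    Eventually.of_forall fun y => ?_, Eventually.of_forall fun y => ?_⟩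
  · ext i
    fin_cases i
    · simp [mul_pow]
    · simp [← mul_assoc]
  · ext i
    fin_cases i
    · simp [mul_pow]
    · simp [← mul_assoc]

theorem hasFDerivAt_of_eq (hh : ∀ y, h y = ![-y 0 + y 1 ^ 2, -Complex.I * y 1]) :
    HasFDerivAt h (LinearMap.toContinuousLinearMap
      (Matrix.toLin' (Matrix.diagonal ![(-1 : ℂ), -Complex.I]))) 0 := by
  obtain rfl : h = fun y => ![-y 0 + y 1 ^ 2, -Complex.I * y 1] := funext hh
  have c := fun i => (ContinuousLinearMap.proj (R := ℂ) (φ := fun _ : Fin 2 => ℂ) i).hasFDerivAt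
    (x := (0 : Fin 2 → ℂ))
  rw [hasFDerivAt_pi']
  intro i
  fin_cases i
  · refine ((c 0).neg.add ((c 1).pow 2)).congr_fderiv ?_
    ext v
    simp
  · refine ((c 1).const_mul (-Complex.I)).congr_fderiv ?_
    ext v
    simp

theorem exp_smul_diagonal : NormedSpace.exp ((2 * Real.pi * Complex.I : ℂ) •
    Matrix.diagonal ![(-3 / 2 : ℂ), -1 / 4]) = Matrix.diagonal ![(-1 : ℂ), -Complex.I] := by
  rw [← Matrix.diagonal_smul, Matrix.exp_diagonal]
  congr 1
  ext i
  rw [Pi.coe_exp, ← Complex.exp_eq_exp_ℂ]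
  fin_cases i
  · simpa using exp_two_pi_I_mul_neg_three_halves
  · simpa using exp_two_pi_I_mul_neg_one_quarter

theorem hasNegativeSpectrum_diagonal :
    HasNegativeSpectrum (Matrix.diagonal ![(-3 / 2 : ℂ), -1 / 4]) := by
  intro μ hμ
  rw [spectrum_diagonal] at hμ
  obtain ⟨i, rfl⟩ := hμ
  fin_cases i <;> norm_num

theorem isNegativeResonance_zero_two :
    IsNegativeResonance ![(-3 / 2 : ℂ), -1 / 4] ![0, 2] 0 := by
  refine ⟨by simp, -1, by norm_num, ?_⟩
  simp
  norm_num

/-- The differences are `0` and `-5/4`. The value `0` is allowed, and it supplies the kernel vector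
`e₁`. -/
theorem linear_nonresonance (j : Fin 2) (k : ℕ) :
    (![-3 / 2, -1 / 4] : Fin 2 → ℂ) 0 - (![-3 / 2, -1 / 4] : Fin 2 → ℂ) j ≠ k + 1 := by
  intro he
  have hk : (0 : ℝ) ≤ k := k.cast_nonneg
  have := congrArg Complex.re he
  fin_cases j <;> norm_num at this <;> linarith

/-- The values are `3/2`, `1/4`, `1/4` and `-1`. The last is the negative resonance, which passes
because only natural numbers are excluded. -/
theorem quadratic_nonresonance (j l : Fin 2) (k : ℕ) :
    (![-3 / 2, -1 / 4] : Fin 2 → ℂ) 0 - (![-3 / 2, -1 / 4] : Fin 2 → ℂ) j -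
      (![-3 / 2, -1 / 4] : Fin 2 → ℂ) l ≠ k := by
  intro he
  have hk : (0 : ℝ) ≤ k := k.cast_nonneg
  have h1 : (3 / 2 : ℝ) ≠ k := fun h1 => by
    have : (3 : ℝ) = 2 * k := by linarith
    have : 3 = 2 * k := by exact_mod_cast this
    omega
  have h2 : (1 / 4 : ℝ) ≠ k := fun h2 => by
    have : (1 : ℝ) = 4 * k := by linarith
    have : 1 = 4 * k := by exact_mod_cast this
    omega
  have := congrArg Complex.re he
  fin_cases j <;> fin_cases l <;> norm_num at this
  · exact h1 (by linarith)
  · exact h2 (by linarith)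
  · exact h2 (by linarith)
  · linarith

/-- The order three error forces the differential of a semi-invariant function to vanish, because
of the resonant monomial. -/
theorem fderiv_eq_zero_of_semiinvariant (hh : ∀ y, h y = ![-y 0 + y 1 ^ 2, -Complex.I * y 1])
    {η : (Fin 2 → ℂ) → ℂ} {D : (Fin 2 → ℂ) →L[ℂ] ℂ} (hη : HasStrictFDerivAt η D 0)
    (hinv : (fun z => η (h z) + η z) =O[𝓝 0] fun z => ‖z‖ ^ 3) : D = 0 := by
  have h00 : h 0 = 0 := by rw [hh]; simp
  have hD1 : D (Pi.single 1 1) = 0 := by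
    have h1 : HasFDerivAt (fun z => η (h z) + η z) (0 : (Fin 2 → ℂ) →L[ℂ] ℂ) 0 :=
      IsBigO.hasFDerivAt (by simpa using hinv) (by norm_num : 1 < 3)
    have h2 : HasFDerivAt η D (h 0) := by rw [h00]; exact hη.hasFDerivAt
    have h3 := congrArg (fun T : (Fin 2 → ℂ) →L[ℂ] ℂ => T (Pi.single 1 1))
      (((h2.comp 0 (hasFDerivAt_of_eq hh)).add hη.hasFDerivAt).unique h1)
    have h4 : (Matrix.diagonal ![(-1 : ℂ), -Complex.I]).mulVec (Pi.single 1 1) =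
        (-Complex.I) • (Pi.single 1 1 : Fin 2 → ℂ) := by
      ext i
      rw [Matrix.mulVec_diagonal]
      fin_cases i <;> simp
    simp only [_root_.add_apply, ContinuousLinearMap.comp_apply, LinearMap.coe_toContinuousLinearMap',
      Matrix.toLin'_apply, h4, map_smul, smul_eq_mul, _root_.zero_apply] at h3
    have h5 : (1 - Complex.I) * D (Pi.single 1 1) = 0 := by linear_combination h3
    refine (mul_eq_zero.1 h5).resolve_left fun h6 => ?_
    simpa using congrArg Complex.re h6
  have hD0 : D (Pi.single 0 1) = 0 := by
    -- `h` permutes these parabolas by `(k, ω) ↦ (-k + ω², -iω)`. Four steps lead from `(0, 1)`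
    -- through `(1, -i)`, `(-2, -1)`, `(3, i)` to `(-4, 1)`: the second coordinate returns, while
    -- the first has drifted by `-4t²`.
    set Z : ℂ → ℂ → ℂ → Fin 2 → ℂ := fun k ω t => ![k * t ^ 2, ω * t] with hZ
    have hZd : ∀ k ω, DifferentiableAt ℂ (Z k ω) 0 := by
      intro k ω
      rw [differentiableAt_pi]
      intro i
      fin_cases i
      · exact (by fun_prop : DifferentiableAt ℂ (fun t : ℂ => k * t ^ 2) 0)
      · exact (by fun_prop : DifferentiableAt ℂ (fun t : ℂ => ω * t) 0)
    have hZ0 : ∀ k ω, Z k ω 0 = 0 := fun k ω => by simp [hZ]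
    have hZt : ∀ k ω, Tendsto (Z k ω) (𝓝 0) (𝓝 0) := fun k ω => by
      simpa [hZ0] using (hZd k ω).continuousAt.tendsto
    have hZO : ∀ k ω, Z k ω =O[𝓝 0] fun t => t := fun k ω => by
      simpa [hZ0] using (hZd k ω).isBigO_sub
    have hF : ∀ k ω, (fun t => η (h (Z k ω t)) + η (Z k ω t)) =O[𝓝 0] fun t => t ^ 3 :=
      fun k ω => (hinv.comp_tendsto (hZt k ω)).trans ((hZO k ω).norm_left.pow 3)
    have hhZ : ∀ k ω t, h (Z k ω t) = Z (-k + ω ^ 2) (-Complex.I * ω) t := by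
      intro k ω t
      rw [hh]
      simp only [hZ, Matrix.cons_val_zero, Matrix.cons_val_one]
      congr 1
      · ring
      · congr 1; ring
    simp only [hhZ] at hF
    have hI : Complex.I ^ 2 = -1 := Complex.I_sq
    have e0 := hF 0 1
    have e1 := hF 1 (-Complex.I)
    have e2 := hF (-2) (-1)
    have e3 := hF 3 Complex.I
    -- In the alternating sum of the four relations the intermediate points cancel, so no second
    -- derivative of `η` is needed.
    have hdiff : (fun t => η (Z (-4) 1 t) - η (Z 0 1 t)) =O[𝓝 0] fun t => t ^ 3 := by
      refine (((e3.sub e2).add e1).sub e0).congr_left fun t => ?_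
      have f0 : (-0 + 1 ^ 2 : ℂ) = 1 := by norm_num
      have f1 : (-1 + (-Complex.I) ^ 2 : ℂ) = -2 := by rw [neg_sq, hI]; norm_num
      have f2 : (- -2 + (-1) ^ 2 : ℂ) = 3 := by norm_num
      have f3 : (-3 + Complex.I ^ 2 : ℂ) = -4 := by rw [hI]; norm_num
      have g1 : -Complex.I * -Complex.I = -1 := by rw [neg_mul_neg, Complex.I_mul_I]
      have g3 : -Complex.I * Complex.I = 1 := by rw [neg_mul, Complex.I_mul_I, neg_neg]
      rw [f0, f1, f2, f3, g1, g3, mul_one, mul_neg_one, neg_neg]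
      ring
    have hlo : (fun t : ℂ => t ^ 3) =o[𝓝 0] fun t : ℂ => t ^ 2 :=
      isLittleO_pow_pow (by norm_num)
    have hpair : Tendsto (fun t => (Z (-4) 1 t, Z 0 1 t)) (𝓝 0)
        (𝓝 ((0 : Fin 2 → ℂ), (0 : Fin 2 → ℂ))) := (hZt _ _).prodMk_nhds (hZt _ _)
    -- Strict differentiability is essential: both points are of size `t`, but their difference is
    -- of size `t²`, and the error must be `o(t²)`.
    have hstr := hη.isLittleO.comp_tendsto hpair
    have hsub : ∀ t, Z (-4) 1 t - Z 0 1 t = (-4 * t ^ 2) • (Pi.single 0 1 : Fin 2 → ℂ) := by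
      intro t
      ext i
      fin_cases i <;> simp [hZ]
    have hO : (fun t => Z (-4) 1 t - Z 0 1 t) =O[𝓝 0] fun t : ℂ => t ^ 2 := by
      simp only [hsub]
      refine IsBigO.of_bound 4 (Eventually.of_forall fun t => ?_)
      rw [norm_smul, norm_mul, Pi.norm_single]
      simp
    have hlin : (fun t : ℂ => -4 * D (Pi.single 0 1) * t ^ 2) =o[𝓝 0] fun t : ℂ => t ^ 2 := by
      refine ((hdiff.trans_isLittleO hlo).sub (hstr.trans_isBigO hO)).congr_left fun t => ?_
      simp only [Function.comp_apply, hsub, map_smul, smul_eq_mul]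
      ring
    have htend := (hlin.mono (nhdsWithin_le_nhds (s := {0}ᶜ))).tendsto_div_nhds_zero
    have hconst : (fun t : ℂ => -4 * D (Pi.single 0 1) * t ^ 2 / t ^ 2) =ᶠ[𝓝[≠] 0]
        fun _ => -4 * D (Pi.single 0 1) := by
      filter_upwards [self_mem_nhdsWithin] with t ht
      exact mul_div_cancel_right₀ _ (pow_ne_zero 2 ht)
    have := tendsto_nhds_unique (tendsto_const_nhds.congr' hconst.symm) htend
    simpa using this
  ext v
  have hv : v = v 0 • Pi.single 0 1 + v 1 • Pi.single 1 1 := by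
    ext i
    fin_cases i <;> simp
  rw [hv, map_add, map_smul, map_smul, hD0, hD1]
  simp

theorem contDiff_quadraticPoly {n : ℕ} (a : Fin n → ℂ) (b : Fin n → Fin n → ℂ) :
    ContDiff ℂ 1 (quadraticPoly a b) := by
  unfold quadraticPoly
  fun_prop

theorem eq_zero_of_fderiv_quadraticPoly_eq_zero {n : ℕ} {a : Fin n → ℂ} {b : Fin n → Fin n → ℂ}
    (hd : HasFDerivAt (quadraticPoly a b) (0 : (Fin n → ℂ) →L[ℂ] ℂ) 0) : a = 0 := by
  funext j
  have hline : HasDerivAt (fun s : ℂ => s • (Pi.single j 1 : Fin n → ℂ)) (Pi.single j 1) 0 := by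
    simpa using (hasDerivAt_id (0 : ℂ)).smul_const (Pi.single j 1 : Fin n → ℂ)
  have h1 : HasDerivAt (fun s : ℂ => quadraticPoly a b (s • Pi.single j 1)) 0 0 := by
    have hd' : HasFDerivAt (quadraticPoly a b) (0 : (Fin n → ℂ) →L[ℂ] ℂ)
        ((0 : ℂ) • (Pi.single j 1 : Fin n → ℂ)) := by rwa [zero_smul]
    exact hd'.comp_hasDerivAt 0 hline
  have h2 : HasDerivAt (fun s : ℂ => a j * s + b j j * s * s) (a j) 0 := by
    refine (((hasDerivAt_id (0 : ℂ)).const_mul (a j)).add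
      (((hasDerivAt_id (0 : ℂ)).const_mul (b j j)).mul (hasDerivAt_id (0 : ℂ)))).congr_deriv ?_
    simp
  have h3 : (fun s : ℂ => quadraticPoly a b (s • Pi.single j 1)) =
      fun s => a j * s + b j j * s * s := by
    funext s
    simp [quadraticPoly, Pi.single_apply]
  rw [h3] at h1
  exact h2.unique h1

/-- The semi-invariant `ψ` of the holonomy is carried by `g = φ⁻¹` to one of `h`, whose differential
must vanish. Pulling back by `φ` gives `dψ(0) = 0`, against `a ≠ 0`. -/
theorem not_isRealizable_of_eq (hh : ∀ y, h y = ![-y 0 + y 1 ^ 2, -Complex.I * y 1]) :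
    ¬ IsRealizable (Matrix.diagonal ![(-3 / 2 : ℂ), -1 / 4]) h := by
  rintro ⟨U, G, γ, f, hG, hγ, hf, φ, ⟨hφ0, hφ, g, hg0, hg, hgφ, hφg⟩, hconj⟩
  obtain ⟨a, b, K, ha, hK⟩ := hf.exists_semiinvariant (i₀ := 0) linear_nonresonance
    quadratic_nonresonance hG hγ
  refine ha (eq_zero_of_fderiv_quadraticPoly_eq_zero (b := b) ?_)
  set ψ := quadraticPoly a b with hψ
  have hψd : DifferentiableAt ℂ ψ 0 := (contDiff_quadraticPoly a b).differentiable one_ne_zero 0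
  have hψs : HasStrictFDerivAt ψ (fderiv ℂ ψ 0) (g 0) := by
    rw [hg0]
    exact (contDiff_quadraticPoly a b).contDiffAt.hasStrictFDerivAt one_ne_zero
  have hηs : HasStrictFDerivAt (ψ ∘ g) ((fderiv ℂ ψ 0).comp (fderiv ℂ g 0)) 0 :=
    hψs.comp 0 hg.hasStrictFDerivAt
  have hgt : Tendsto g (𝓝 0) (𝓝 0) := by
    simpa [hg0] using hg.continuousAt.tendsto
  -- Continuity of `f` at `0` is not part of the definition of holonomy; it comes from the bound `‖f
  -- y‖ ≤ K ‖y‖` on lifts.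
  have hft : Tendsto f (𝓝 0) (𝓝 0) := by
    refine squeeze_zero_norm' (hK.mono fun y hy => hy.1) ?_
    have : Continuous fun y : Fin 2 → ℂ => K * ‖y‖ := by fun_prop
    simpa using this.tendsto 0
  have hfg : ∀ᶠ z in 𝓝 (0 : Fin 2 → ℂ), f (g z) = g (h z) := by
    filter_upwards [hgt.eventually hconj, hφg, (hft.comp hgt).eventually hgφ] with z h1 h2 h3
    rw [h2] at h1
    rw [← h1]
    exact h3.symm
  have hinv : (fun z => (ψ ∘ g) (h z) + (ψ ∘ g) z) =O[𝓝 0] fun z => ‖z‖ ^ 3 := by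
    have h1 : (fun z => ψ (f (g z)) + ψ (g z)) =O[𝓝 0] fun z => ‖g z‖ ^ 3 := by
      refine IsBigO.of_bound K ?_
      filter_upwards [hgt.eventually hK] with z hz
      have := hz.2
      rw [show (![-3 / 2, -1 / 4] : Fin 2 → ℂ) 0 = -3 / 2 from rfl,
        exp_two_pi_I_mul_neg_three_halves, neg_one_mul, sub_neg_eq_add] at this
      simpa using this
    have h2 : g =O[𝓝 0] fun z => z := by
      simpa [hg0] using hg.differentiableAt.isBigO_sub
    refine (h1.congr' ?_ EventuallyEq.rfl).trans (h2.norm_norm.pow 3)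
    filter_upwards [hfg] with z hz
    simp [hz]
  have hD := fderiv_eq_zero_of_semiinvariant hh hηs hinv
  have hη0 : HasFDerivAt (ψ ∘ g) (0 : (Fin 2 → ℂ) →L[ℂ] ℂ) (φ 0) := by
    rw [hφ0, ← hD]; exact hηs.hasFDerivAt
  have hcomp := hη0.comp 0 hφ.differentiableAt.hasFDerivAt
  rw [ContinuousLinearMap.zero_comp] at hcomp
  refine hcomp.congr_of_eventuallyEq ?_
  filter_upwards [hgφ] with y hy
  simp [hy]

end Example

end Foliation

end

theorem proposition4p1
    (A : Matrix (Fin 2) (Fin 2) ℂ) (hA : A = Matrix.diagonal ![-3 / 2, -1 / 4])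
    (h : (Fin 2 → ℂ) → (Fin 2 → ℂ))
    (hh : ∀ y, h y = ![-y 0 + y 1 ^ 2, -Complex.I * y 1]) :
    (Foliation.HasNegativeSpectrum A ∧ Foliation.IsDiffGerm h ∧ Foliation.HasLinearPartExp A h ∧
      Foliation.IsNegativeResonance ![-3 / 2, -1 / 4] ![0, 2] 0) ∧
    ¬ Foliation.IsRealizable A h ∧
    ¬ (∀ (n : ℕ) (B : Matrix (Fin n) (Fin n) ℂ) (g : (Fin n → ℂ) → (Fin n → ℂ)),
        Foliation.HasNegativeSpectrum B → Foliation.IsDiffGerm g →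
        Foliation.HasLinearPartExp B g → Foliation.IsRealizable B g) := by
  have hspec : Foliation.HasNegativeSpectrum A := hA ▸ Foliation.hasNegativeSpectrum_diagonal
  have hdiff := Foliation.isDiffGerm_of_eq hh
  have hlin : Foliation.HasLinearPartExp A h := by
    rw [Foliation.HasLinearPartExp, hA, Foliation.exp_smul_diagonal]
    exact Foliation.hasFDerivAt_of_eq hh
  have hnot : ¬ Foliation.IsRealizable A h := hA ▸ Foliation.not_isRealizable_of_eq hh
  exact ⟨⟨hspec, hdiff, hlin, Foliation.isNegativeResonance_zero_two⟩, hnot,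
    fun hall => hnot (hall 2 A h hspec hdiff hlin)⟩
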